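/- Let $\mathbb K$ be either $\mathbb R$ or the circle $\mathbb S=[0,1)$ (functions on $\mathbb S$ being functions on $\mathbb R$ of period $1$), and let $n\ge 1$ be an integer. Consider the Cauchy problem $$u_t-2uu_x=\partial_x\Lambda^{-2}\big(u^2+(u^2)_x\big),\qquad u(0,x)=u_0(x),\qquad x\in\mathbb K,\tag{1}$$ where $\partial_x\Lambda^{-2}f=(\partial_x g)*f$ (convolution over $\mathbb K$) and $g$ is the Green function of $1-\partial_x^2$ on $\mathbb K$, that is $g(x)=\frac12e^{-|x|}$ if $\mathbb K=\mathbb R$ and $g(x)=\frac{\cosh(x-\lfloor x\rfloor-1/2)}{2\sinh(1/2)}$ if $\mathbb K=\mathbb S$. For $0<T\le\infty$, a strong solution of (1) on $[0,T)$ is a function $u\in C^0([0,T);H^n(\mathbb K))\cap C^1([0,T);H^{n-1}(\mathbb K))$ which is $C^1$ in $(t,x)\in[0,T)\times\mathbb R$ (with one-sided time derivatives at $t=0$) and satisfies (1) at every point (the initial condition for almost every $x$). Let $u_0\in H^n(\mathbb K)\cap L^1(\mathbb K)$ be such that $m_0:=u_0-u_0''\ge 0$ in the sense of distributions. Then there is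 a constant $K>0$, depending only on $\mathbb K$, $n$ and $u_0$, such that for every $T\in(0,\infty]$ and every strong solution $u$ of (1) on $[0,T)$, $$\|u_x(t,\cdot)\|_{L^\infty(\mathbb K)}\le K\qquad\text{for all }t\in[0,T).$$ -/

import Mathlib

noncomputable section

namespace PseudoEq

open MeasureTheory Set Filter Topology
open scoped ContDiff ENNReal

/-- The two spatial domains: the real line, and the circle of length one. Functions on the circle
are represented by functions on the real line of period one. -/
inductive SpatialDomain where
  | line : SpatialDomain
  | circle : SpatialDomain

namespace SpatialDomain

/-- The set over which one integrates: the whole line, respectively one period `[0, 1)`. -/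
def carrier : SpatialDomain → Set ℝ
  | line => Set.univ
  | circle => Set.Ico 0 1

/-- Lebesgue measure on the domain. -/
def measure (K : SpatialDomain) : Measure ℝ := volume.restrict K.carrier

/-- `f` is a function on the domain: no condition on the line, period one on the circle. -/
def IsFunctionOn : SpatialDomain → (ℝ → ℝ) → Prop
  | line, _ => True
  | circle, f => Function.Periodic f 1

/-- The Green function `g` of `1 - ∂ₓ²`, that is `(1 - ∂ₓ²)⁻¹ f = g ∗ f`. -/
def green : SpatialDomain → ℝ → ℝ
  | line, x => Real.exp (-|x|) / 2
  | circle, x => Real.cosh (x - ⌊x⌋ - 1 / 2) / (2 * Real.sinh (1 / 2))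

/-- The derivative `∂ₓ g` of the Green function (away from its kinks). -/
def greenDeriv : SpatialDomain → ℝ → ℝ
  | line, x => -(SignType.sign x : ℝ) * Real.exp (-|x|) / 2
  | circle, x => Real.sinh (x - ⌊x⌋ - 1 / 2) / (2 * Real.sinh (1 / 2))

theorem hasDerivAt_green_line {x : ℝ} (hx : x ≠ 0) :
    HasDerivAt line.green (line.greenDeriv x) x := by
  have h := ((hasDerivAt_abs hx).neg.exp.div_const 2)
  have e : line.greenDeriv x = Real.exp (-|x|) * -(SignType.sign x : ℝ) / 2 := by
    simp only [greenDeriv]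
    ring
  rw [e]
  exact h

theorem hasDerivAt_green_circle {x : ℝ} (hx : x ∈ Set.Ioo (0 : ℝ) 1) :
    HasDerivAt circle.green (circle.greenDeriv x) x := by
  have h0 : ⌊x⌋ = 0 := Int.floor_eq_zero_iff.2 ⟨hx.1.le, hx.2⟩
  have h : HasDerivAt (fun y : ℝ => Real.cosh (y - 1 / 2) / (2 * Real.sinh (1 / 2)))
      (Real.sinh (x - 1 / 2) * 1 / (2 * Real.sinh (1 / 2))) x :=
    ((hasDerivAt_id' x).sub_const (1 / 2)).cosh.div_const _
  have e : circle.greenDeriv x = Real.sinh (x - 1 / 2) * 1 / (2 * Real.sinh (1 / 2)) := by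
    simp only [greenDeriv, h0, Int.cast_zero, sub_zero, mul_one]
  rw [e]
  refine h.congr_of_eventuallyEq ?_
  filter_upwards [Ioo_mem_nhds hx.1 hx.2] with y hy
  have h1 : ⌊y⌋ = 0 := Int.floor_eq_zero_iff.2 ⟨hy.1.le, hy.2⟩
  simp only [green, h1, Int.cast_zero, sub_zero]

/-- The operator `∂ₓ (1 - ∂ₓ²)⁻¹`, i.e. convolution with `∂ₓ g` over the domain. -/
def dxLambdaInv (K : SpatialDomain) (f : ℝ → ℝ) (x : ℝ) : ℝ :=
  ∫ y, K.greenDeriv (x - y) * f y ∂K.measure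

end SpatialDomain

/-- `h` is a weak derivative of order `k` of `f`. (For functions of period one, testing against
compactly supported functions on the line is the same as testing against smooth periodic ones.) -/
def IsWeakDeriv (k : ℕ) (f h : ℝ → ℝ) : Prop :=
  LocallyIntegrable f volume ∧ LocallyIntegrable h volume ∧
    ∀ φ : ℝ → ℝ, ContDiff ℝ ∞ φ → HasCompactSupport φ →
      ∫ x, f x * iteratedDeriv k φ x = (-1) ^ k * ∫ x, h x * φ x

/-- The norm of the Sobolev space `Hⁿ(K)`, with values in `[0, ∞]`:
`(∑_{k ≤ n} ‖∂ₓᵏ f‖²_{L²(K)})^{1/2}`. Weak derivatives are unique up to null sets, so that the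
infimum does not depend on a choice; it is `∞` if some weak derivative of order `≤ n` does
not exist. -/
def sobolevNorm (K : SpatialDomain) (n : ℕ) (f : ℝ → ℝ) : ℝ≥0∞ :=
  ⨅ (D : ℕ → ℝ → ℝ) (_ : ∀ k ≤ n, IsWeakDeriv k f (D k)),
    (∑ k ∈ Finset.range (n + 1), eLpNorm (D k) 2 K.measure ^ 2) ^ (1 / 2 : ℝ)

/-- `f ∈ Hⁿ(K)`. -/
def MemSobolev (K : SpatialDomain) (n : ℕ) (f : ℝ → ℝ) : Prop :=
  K.IsFunctionOn f ∧ sobolevNorm K n f < ⊤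

/-- The time interval `[0, T)`, with `T = ∞` allowed. -/
def timeInterval (T : EReal) : Set ℝ := {t : ℝ | 0 ≤ t ∧ (t : EReal) < T}

/-- `u ∈ C⁰([0, T); Hⁿ(K))`, where `u t` is the function `x ↦ u(t, x)`. -/
def ContinuousInSobolev (K : SpatialDomain) (n : ℕ) (T : EReal) (u : ℝ → ℝ → ℝ) : Prop :=
  (∀ t ∈ timeInterval T, MemSobolev K n (u t)) ∧
    ∀ t₀ ∈ timeInterval T,
      Tendsto (fun t => sobolevNorm K n (fun x => u t x - u t₀ x))
        (𝓝[timeInterval T] t₀) (𝓝 0)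

/-- `u ∈ C¹([0, T); Hⁿ(K))`: the difference quotients converge in `Hⁿ(K)`, and the limit is
continuous in time with values in `Hⁿ(K)`. -/
def ContDiffInSobolev (K : SpatialDomain) (n : ℕ) (T : EReal) (u : ℝ → ℝ → ℝ) : Prop :=
  ContinuousInSobolev K n T u ∧
    ∃ w : ℝ → ℝ → ℝ, ContinuousInSobolev K n T w ∧
      ∀ t₀ ∈ timeInterval T,
        Tendsto (fun t => sobolevNorm K n (fun x => (u t x - u t₀ x) / (t - t₀) - w t₀ x))
          (𝓝[timeInterval T \ {t₀}] t₀) (𝓝 0)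

/-- `u` is a (strong) solution on `[0, T)` of
`u_t - 2 u u_x = ∂ₓ (1 - ∂ₓ²)⁻¹ (u² + (u²)_x)` with initial datum `u₀`, of regularity `Hⁿ`:
`u ∈ C⁰([0, T); Hⁿ) ∩ C¹([0, T); Hⁿ⁻¹)` is a `C¹` function of `(t, x)`
(derivatives at `t = 0` are one-sided) which satisfies the equation at every point. -/
structure IsStrongSolution (K : SpatialDomain) (n : ℕ) (u₀ : ℝ → ℝ) (T : EReal)
    (u : ℝ → ℝ → ℝ) : Prop where
  continuous_sobolev : ContinuousInSobolev K n T u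
  contDiff_sobolev : ContDiffInSobolev K (n - 1) T u
  contDiff : ContDiffOn ℝ 1 (fun p : ℝ × ℝ => u p.1 p.2) (timeInterval T ×ˢ Set.univ)
  equation : ∀ t ∈ timeInterval T, ∀ x : ℝ,
    derivWithin (fun s => u s x) (timeInterval T) t - 2 * u t x * deriv (u t) x =
      K.dxLambdaInv (fun y => u t y ^ 2 + deriv (fun z => u t z ^ 2) y) x
  initial : u 0 =ᵐ[volume] u₀

/-- The momentum `m₀ = u₀ - u₀''` is non-negative, in the sense of distributions. (If `u₀''` is
a locally integrable function this means `m₀ ≥ 0` almost everywhere.) -/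
def MomentumNonneg (u₀ : ℝ → ℝ) : Prop :=
  ∀ φ : ℝ → ℝ, ContDiff ℝ ∞ φ → HasCompactSupport φ → (∀ x, 0 ≤ φ x) →
    0 ≤ ∫ x, u₀ x * (φ x - iteratedDeriv 2 φ x)

end PseudoEq

end

noncomputable section

namespace PseudoEq

open MeasureTheory Set Filter Topology
open scoped ContDiff ENNReal

/-! Put p = u - u_x. Since 1 - ∂ₓ² = (1 - ∂ₓ)(1 + ∂ₓ), the right-hand side F of (1) satisfies F -
F_x = (u²)_x, and (1) becomes the conservation law p_t = 2 (u p)_x, whose mass is carried by the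
characteristics q' = -2 u(t, q). The momentum is m = p + p_x = e^{-x} (e^x p)_x, so m ≥ 0 means that
e^x p is nondecreasing. Along a characteristic, R = e^q p solves the Riccati equation R' = -2 e^{-q}
R²; comparing two ordered characteristics shows that the monotonicity persists
(`monotone_exp_mul_density`).

A bounded function with m ≥ 0 satisfies |u_x| ≤ u (`deriv_le_self_of_monotone`,
`neg_le_deriv_of_monotone`), so an upper bound of u suffices. From (e^{-y} u)_y = -e^{-y} p and p ≥
0 one gets u(a) ≤ e^{a-b} u(b) + ∫_a^b p for a ≤ b. By conservation the integral is the initial mass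
between the feet of two characteristics, which is controlled by the initial datum
(`le_exp_mul_add`). On the line b → ∞ removes the first term; on the circle b = a + 1 lets it be
absorbed.

A solution is only C¹, so p may have no derivatives. The conservation law is therefore used through
a potential U with U_x = p and U_t = 2 u p, and m ≥ 0 through the monotonicity of e^x p. -/

/-! ### Comparison of linear differential inequalities, and averaged difference quotients. -/

/-- Comparison for the scalar linear differential inequality `D' ≥ -a D`. -/
theorem le_exp_integral_mul_of_neg_mul_le_deriv {a D D' : ℝ → ℝ} {s t : ℝ} (hst : s ≤ t)
    (ha : Continuous a) (hD : ContinuousOn D (Icc s t))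
    (hD' : ∀ r ∈ Ioo s t, HasDerivAt D (D' r) r) (h : ∀ r ∈ Ioo s t, -a r * D r ≤ D' r) :
    D s ≤ Real.exp (∫ r in s..t, a r) * D t := by
  have hA : ∀ r, HasDerivAt (fun r => ∫ x in s..r, a x) (a r) r := fun r =>
    intervalIntegral.integral_hasDerivAt_right (ha.intervalIntegrable _ _)
      (ha.stronglyMeasurableAtFilter _ _) ha.continuousAt
  have hE : ∀ r ∈ Ioo s t, HasDerivAt (fun r => Real.exp (∫ x in s..r, a x) * D r)
      (Real.exp (∫ x in s..r, a x) * a r * D r + Real.exp (∫ x in s..r, a x) * D' r) r :=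
    fun r hr => (hA r).exp.mul (hD' r hr)
  have hmono : MonotoneOn (fun r => Real.exp (∫ x in s..r, a x) * D r) (Icc s t) := by
    refine monotoneOn_of_deriv_nonneg (convex_Icc s t) ?_ ?_ ?_
    · exact ContinuousOn.mul
        (Continuous.continuousOn
          (continuous_iff_continuousAt.2 fun r => (hA r).exp.continuousAt)) hD
    · rw [interior_Icc]
      exact fun r hr => (hE r hr).differentiableAt.differentiableWithinAt
    · rw [interior_Icc]
      intro r hr
      rw [(hE r hr).deriv]
      have h1 := h r hr
      have h2 := (Real.exp_pos (∫ x in s..r, a x)).le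
      nlinarith [mul_le_mul_of_nonneg_left h1 h2]
  have := hmono (left_mem_Icc.2 hst) (right_mem_Icc.2 hst) hst
  simpa using this

/-- The average of `f` over the segment from `x` to `x + h`. -/
def segmentAverage (f : ℝ → ℝ) (x h : ℝ) : ℝ := ∫ θ in (0 : ℝ)..1, f (x + h * θ)

theorem mul_segmentAverage (f : ℝ → ℝ) (x h : ℝ) :
    h * segmentAverage f x h = ∫ y in x..x + h, f y := by
  simp [segmentAverage, intervalIntegral.mul_integral_comp_add_mul]

theorem segmentAverage_zero (f : ℝ → ℝ) (x : ℝ) : segmentAverage f x 0 = f x := by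
  simp [segmentAverage]

/-- Averages stand in for difference quotients because they stay continuous down to step zero. -/
theorem continuous_segmentAverage {X : Type*} [TopologicalSpace X] {f : X → ℝ → ℝ} {x h : X → ℝ}
    (hf : Continuous fun p : X × ℝ => f p.1 p.2) (hx : Continuous x) (hh : Continuous h) :
    Continuous fun p => segmentAverage (f p) (x p) (h p) := by
  unfold segmentAverage
  refine intervalIntegral.continuous_parametric_intervalIntegral_of_continuous' ?_ 0 1
  exact hf.comp (continuous_fst.prodMk
    ((hx.comp continuous_fst).add ((hh.comp continuous_fst).mul continuous_snd)))

/-! ### The conservation law for p and its characteristics. -/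

/-- A bounded `C¹` solution on `[0, τ]` of `p_t = 2 (u p)_x` with `p = u - u_x`. The functions are
extended continuously to all times, the time derivative is only required inside the interval, and
the equation is written as `u_t = (u_t + 2 u p)_x`. -/
structure IsTransportSolution (τ : ℝ) (u ux ut : ℝ → ℝ → ℝ) : Prop where
  continuous : Continuous fun p : ℝ × ℝ => u p.1 p.2
  continuous_ux : Continuous fun p : ℝ × ℝ => ux p.1 p.2
  continuous_ut : Continuous fun p : ℝ × ℝ => ut p.1 p.2
  hasDerivAt_x : ∀ t x, HasDerivAt (u t) (ux t x) x
  hasDerivAt_t : ∀ t ∈ Ioo 0 τ, ∀ x, HasDerivAt (fun s => u s x) (ut t x) t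
  bounded : ∃ M, ∀ t x, |u t x| ≤ M
  equation : ∀ t x, HasDerivAt (fun y => ut t y + 2 * u t y * (u t y - ux t y)) (ut t x) x

/-- A characteristic of the equation on `[0, τ]`. -/
structure IsCharacteristic (τ : ℝ) (u : ℝ → ℝ → ℝ) (q : ℝ → ℝ) : Prop where
  continuous : Continuous q
  hasDerivAt : ∀ t ∈ Ioo 0 τ, HasDerivAt q (-2 * u t (q t)) t

namespace IsTransportSolution

variable {τ : ℝ} {u ux ut : ℝ → ℝ → ℝ}

theorem continuous_density (h : IsTransportSolution τ u ux ut) :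
    Continuous fun p : ℝ × ℝ => u p.1 p.2 - ux p.1 p.2 :=
  h.continuous.sub h.continuous_ux

theorem sub_eq_mul_segmentAverage (h : IsTransportSolution τ u ux ut) (t x d : ℝ) :
    u t (x + d) - u t x = d * segmentAverage (ux t) x d := by
  rw [mul_segmentAverage, intervalIntegral.integral_eq_sub_of_hasDerivAt
    (fun y _ => h.hasDerivAt_x t y)]
  exact (h.continuous_ux.comp (Continuous.prodMk_right t)).intervalIntegrable _ _

/-- The velocity is bounded and locally Lipschitz in x, so Picard–Lindelöf applies on all of [0, τ],
with the position prescribed at the final time. -/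
theorem exists_characteristic (h : IsTransportSolution τ u ux ut) (hτ : 0 ≤ τ) (x : ℝ) :
    ∃ q, IsCharacteristic τ u q ∧ q τ = x := by
  obtain ⟨M, hM⟩ := h.bounded
  have hM0 : 0 ≤ M := (abs_nonneg _).trans (hM 0 0)
  set a : ℝ := 2 * M * τ with ha
  have ha0 : 0 ≤ a := by positivity
  have hcomp : IsCompact (Icc 0 τ ×ˢ Metric.closedBall x a) :=
    isCompact_Icc.prod (isCompact_closedBall x a)
  obtain ⟨B, hB⟩ := hcomp.exists_bound_of_continuousOn h.continuous_ux.continuousOn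
  have hB0 : 0 ≤ B := (norm_nonneg _).trans
    (hB (0, x) ⟨left_mem_Icc.2 hτ, Metric.mem_closedBall_self ha0⟩)
  -- The speed is at most 2M, so within time τ a curve cannot leave the ball of radius a = 2Mτ; only
  -- there is the Lipschitz constant 2B needed.
  have hPL : IsPicardLindelof (fun t y => -2 * u t y) (tmin := 0) (tmax := τ)
      ⟨τ, right_mem_Icc.2 hτ⟩ x ⟨a, ha0⟩ 0 ⟨2 * M, by positivity⟩ ⟨2 * B, by positivity⟩ := by
    refine ⟨?_, ?_, ?_, ?_⟩
    · intro t ht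
      refine Convex.lipschitzOnWith_of_nnnorm_hasDerivWithin_le
        (f' := fun y => -2 * ux t y) (convex_closedBall x a)
        (fun y _ => ((h.hasDerivAt_x t y).const_mul (-2)).hasDerivWithinAt) ?_
      intro y hy
      have h1 := hB (t, y) ⟨ht, hy⟩
      have h2 : ‖-2 * ux t y‖ ≤ 2 * B := by simpa [norm_mul] using h1
      exact h2
    · intro y _
      exact ((h.continuous.comp (Continuous.prodMk_left y)).const_mul (-2)).continuousOn
    · intro t _ y _
      have h2 : ‖-2 * u t y‖ ≤ 2 * M := by simpa [norm_mul] using hM t y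
      exact h2
    · have h2 : 2 * M * max (τ - τ) (τ - 0) ≤ a - 0 := by simp [ha, hτ]
      exact h2
  obtain ⟨α, hα, hα'⟩ := hPL.exists_eq_forall_mem_Icc_hasDerivWithinAt₀
  have hcα : ContinuousOn α (Icc 0 τ) := fun t ht => (hα' t ht).continuousWithinAt
  -- Freezing the curve outside [0, τ] makes it continuous on all of ℝ.
  refine ⟨fun t => α (projIcc 0 τ hτ t), ⟨?_, ?_⟩, ?_⟩
  · exact (continuousOn_iff_continuous_domRestrict.1 hcα).comp continuous_projIcc
  · intro t ht
    have hev : (fun t => α (projIcc 0 τ hτ t)) =ᶠ[𝓝 t] α := by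
      filter_upwards [Icc_mem_nhds ht.1 ht.2] with s hs
      rw [projIcc_of_mem hτ hs]
    have h1 := (hα' t (Ioo_subset_Icc_self ht)).hasDerivAt (Icc_mem_nhds ht.1 ht.2)
    have h2 := h1.congr_of_eventuallyEq hev
    rw [projIcc_of_mem hτ (Ioo_subset_Icc_self ht)]
    exact h2
  · simpa using hα

/-- The difference of two characteristics solves a linear homogeneous equation whose coefficient is
an average of u_x, so its sign at τ is inherited by earlier times. -/
theorem characteristic_le (h : IsTransportSolution τ u ux ut) {q r : ℝ → ℝ}
    (hq : IsCharacteristic τ u q) (hr : IsCharacteristic τ u r) (hqr : q τ ≤ r τ) {t : ℝ}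
    (ht : t ∈ Icc 0 τ) : q t ≤ r t := by
  have key := le_exp_integral_mul_of_neg_mul_le_deriv (s := t) (t := τ)
    (D := fun t => q t - r t)
    (D' := fun t => -2 * u t (q t) - -2 * u t (r t))
    (a := fun t => 2 * segmentAverage (ux t) (r t) (q t - r t)) ht.2
    ((continuous_segmentAverage h.continuous_ux hr.continuous
      (hq.continuous.sub hr.continuous)).const_mul 2)
    (hq.continuous.sub hr.continuous).continuousOn
    (fun s hs => (hq.hasDerivAt s ⟨ht.1.trans_lt hs.1, hs.2⟩).sub
      (hr.hasDerivAt s ⟨ht.1.trans_lt hs.1, hs.2⟩))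
    (fun s _ => by
      have := h.sub_eq_mul_segmentAverage s (r s) (q s - r s)
      rw [add_sub_cancel] at this
      linarith)
  have : Real.exp (∫ s in t..τ, 2 * segmentAverage (ux s) (r s) (q s - r s)) * (q τ - r τ) ≤ 0 :=
    mul_nonpos_of_nonneg_of_nonpos (Real.exp_pos _).le (by linarith)
  linarith

/-- The potential `U` with `U_x = p` and `U_t = 2 u p`. -/
def potential (u ux : ℝ → ℝ → ℝ) (t x : ℝ) : ℝ :=
  (∫ y in (0 : ℝ)..x, (u t y - ux t y)) + ∫ s in (0 : ℝ)..t, 2 * u s 0 * (u s 0 - ux s 0)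

theorem hasDerivAt_potential_x (h : IsTransportSolution τ u ux ut) (t x : ℝ) :
    HasDerivAt (potential u ux t) (u t x - ux t x) x := by
  have hc : Continuous fun y => u t y - ux t y :=
    h.continuous_density.comp (Continuous.prodMk_right t)
  exact (intervalIntegral.integral_hasDerivAt_right (hc.intervalIntegrable _ _)
      (hc.stronglyMeasurableAtFilter _ _) hc.continuousAt).add_const _

theorem potential_sub (h : IsTransportSolution τ u ux ut) (t a b : ℝ) :
    potential u ux t b - potential u ux t a = ∫ y in a..b, (u t y - ux t y) := by
  rw [intervalIntegral.integral_eq_sub_of_hasDerivAt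
    (fun y _ => h.hasDerivAt_potential_x t y)]
  exact (h.continuous_density.comp (Continuous.prodMk_right t)).intervalIntegrable _ _

theorem continuous_potential (h : IsTransportSolution τ u ux ut) :
    Continuous fun p : ℝ × ℝ => potential u ux p.1 p.2 := by
  unfold potential
  refine Continuous.add ?_ ?_
  · have := intervalIntegral.continuous_parametric_primitive_of_continuous (μ := volume)
      (a₀ := (0 : ℝ)) (f := fun t y => u t y - ux t y) h.continuous_density
    exact this
  · refine (intervalIntegral.continuous_primitive (fun a b => ?_) 0).comp continuous_fst
    have h1 := h.continuous.comp (Continuous.prodMk_left (0 : ℝ))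
    have h2 := h.continuous_ux.comp (Continuous.prodMk_left (0 : ℝ))
    exact Continuous.intervalIntegrable ((h1.const_mul 2).mul (h1.sub h2)) _ _

theorem hasDerivAt_integral_t (h : IsTransportSolution τ u ux ut) {t : ℝ} (ht : t ∈ Ioo 0 τ)
    (x : ℝ) : HasDerivAt (fun s => ∫ y in (0 : ℝ)..x, u s y) (∫ y in (0 : ℝ)..x, ut t y) t := by
  obtain ⟨B, hB⟩ := ((isCompact_Icc (a := 0) (b := τ)).prod
    (isCompact_uIcc (a := (0 : ℝ)) (b := x))).exists_bound_of_continuousOn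
      h.continuous_ut.continuousOn
  have hc : ∀ s, Continuous (u s) := fun s => h.continuous.comp (Continuous.prodMk_right s)
  refine (intervalIntegral.hasDerivAt_integral_of_dominated_loc_of_deriv_le
    (s := Ioo 0 τ) (bound := fun _ => B) (F' := ut) (Ioo_mem_nhds ht.1 ht.2)
    (Eventually.of_forall fun s => (hc s).aestronglyMeasurable) ((hc t).intervalIntegrable _ _)
    (h.continuous_ut.comp (Continuous.prodMk_right t)).aestronglyMeasurable ?_ (by simp) ?_).2
  · exact Eventually.of_forall fun y hy s hs =>
      hB (s, y) ⟨Ioo_subset_Icc_self hs, uIoc_subset_uIcc hy⟩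
  · exact Eventually.of_forall fun y _ s hs => h.hasDerivAt_t s hs y

theorem hasDerivAt_potential_t (h : IsTransportSolution τ u ux ut) {t : ℝ} (ht : t ∈ Ioo 0 τ)
    (x : ℝ) : HasDerivAt (fun s => potential u ux s x) (2 * u t x * (u t x - ux t x)) t := by
  have hc : ∀ s, Continuous (u s) := fun s => h.continuous.comp (Continuous.prodMk_right s)
  have hcx : ∀ s, Continuous (ux s) := fun s => h.continuous_ux.comp (Continuous.prodMk_right s)
  -- Integrating u_x out leaves only terms that can be differentiated in time; u_x itself may have
  -- no time derivative.
  have hsplit : ∀ s, (∫ y in (0 : ℝ)..x, (u s y - ux s y)) =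
      (∫ y in (0 : ℝ)..x, u s y) - (u s x - u s 0) := by
    intro s
    rw [intervalIntegral.integral_sub ((hc s).intervalIntegrable _ _)
      ((hcx s).intervalIntegrable _ _), intervalIntegral.integral_eq_sub_of_hasDerivAt
      (fun y _ => h.hasDerivAt_x s y) ((hcx s).intervalIntegrable _ _)]
  have hint : ∫ y in (0 : ℝ)..x, ut t y =
      (ut t x + 2 * u t x * (u t x - ux t x)) - (ut t 0 + 2 * u t 0 * (u t 0 - ux t 0)) :=
    intervalIntegral.integral_eq_sub_of_hasDerivAt (fun y _ => h.equation t y)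
      ((h.continuous_ut.comp (Continuous.prodMk_right t)).intervalIntegrable _ _)
  have h0 : Continuous fun s => 2 * u s 0 * (u s 0 - ux s 0) :=
    ((h.continuous.comp (Continuous.prodMk_left (0 : ℝ))).const_mul 2).mul
      (h.continuous_density.comp (Continuous.prodMk_left (0 : ℝ)))
  have hprim : HasDerivAt (fun s => ∫ r in (0 : ℝ)..s, 2 * u r 0 * (u r 0 - ux r 0))
      (2 * u t 0 * (u t 0 - ux t 0)) t :=
    intervalIntegral.integral_hasDerivAt_right (h0.intervalIntegrable _ _)
      (h0.stronglyMeasurableAtFilter _ _) h0.continuousAt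
  unfold potential
  simp only [hsplit]
  refine (((h.hasDerivAt_integral_t ht x).fun_sub
    ((h.hasDerivAt_t t ht x).fun_sub (h.hasDerivAt_t t ht 0))).fun_add hprim).congr_deriv ?_
  rw [hint]
  ring

/-- Both partial derivatives of U are continuous, so U is strictly differentiable and the chain rule
holds along any curve. The factor 2u + a' vanishes exactly for characteristics. -/
theorem hasDerivAt_potential_comp (h : IsTransportSolution τ u ux ut) {t a' : ℝ} {a : ℝ → ℝ}
    (ht : t ∈ Ioo 0 τ) (ha : HasDerivAt a a' t) :
    HasDerivAt (fun s => potential u ux s (a s))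
      ((u t (a t) - ux t (a t)) * (2 * u t (a t) + a')) t := by
  have hf := hasStrictFDerivAt_uncurry_coprod (𝕜 := ℝ) (u := (t, a t)) (f := potential u ux)
    (f₁ := fun t x => ContinuousLinearMap.toSpanSingleton ℝ (2 * u t x * (u t x - ux t x)))
    (f₂ := fun t x => ContinuousLinearMap.toSpanSingleton ℝ (u t x - ux t x))
    (by
      filter_upwards [(continuous_fst.tendsto (t, a t)).eventually (Ioo_mem_nhds ht.1 ht.2)]
        with v hv
      exact (h.hasDerivAt_potential_t hv v.2).hasFDerivAt)
    (Eventually.of_forall fun v => (h.hasDerivAt_potential_x v.1 v.2).hasFDerivAt)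
    (by
      refine Continuous.continuousAt ?_
      exact (ContinuousLinearMap.toSpanSingletonCLE (𝕜 := ℝ) (E := ℝ)).continuous.comp
        ((h.continuous.const_mul 2).mul h.continuous_density))
    (by
      refine Continuous.continuousAt ?_
      exact (ContinuousLinearMap.toSpanSingletonCLE (𝕜 := ℝ) (E := ℝ)).continuous.comp h.continuous_density)
  refine (hf.hasFDerivAt.comp_hasDerivAt t ((hasDerivAt_id t).prodMk ha)).congr_deriv ?_
  simp [Function.HasUncurry.uncurry]
  ring

theorem potential_characteristic (h : IsTransportSolution τ u ux ut) (hτ : 0 ≤ τ) {q : ℝ → ℝ}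
    (hq : IsCharacteristic τ u q) : potential u ux τ (q τ) = potential u ux 0 (q 0) := by
  have hd : ∀ t ∈ Ioo 0 τ, HasDerivAt (fun s => potential u ux s (q s)) 0 t := by
    intro t ht
    exact (h.hasDerivAt_potential_comp ht (hq.hasDerivAt t ht)).congr_deriv (by ring)
  have := intervalIntegral.integral_eq_sub_of_hasDerivAt_of_le hτ
    (h.continuous_potential.comp (continuous_id.prodMk hq.continuous)).continuousOn hd (by simp)
  simp at this
  linarith

/-- The mass between two characteristics is conserved. -/
theorem integral_density_characteristic (h : IsTransportSolution τ u ux ut) (hτ : 0 ≤ τ)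
    {q r : ℝ → ℝ} (hq : IsCharacteristic τ u q) (hr : IsCharacteristic τ u r) :
    ∫ y in q τ..r τ, (u τ y - ux τ y) = ∫ y in q 0..r 0, (u 0 y - ux 0 y) := by
  rw [← h.potential_sub, ← h.potential_sub, h.potential_characteristic hτ hq,
    h.potential_characteristic hτ hr]

/-- This is the integrated form of dp/dt = 2 u_x p along q. As p_x may not exist, it is the limit d
→ 0 of the evolution of the mean of p over [q, q + d], where U can be differentiated. -/
theorem density_characteristic (h : IsTransportSolution τ u ux ut) {q : ℝ → ℝ}
    (hq : IsCharacteristic τ u q) {t : ℝ} (ht : t ∈ Icc 0 τ) :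
    u t (q t) - ux t (q t) = u 0 (q 0) - ux 0 (q 0) +
      ∫ s in (0 : ℝ)..t, 2 * ux s (q s) * (u s (q s) - ux s (q s)) := by
  have hfix : ∀ t, Continuous fun d => segmentAverage (fun y => u t y - ux t y) (q t) d :=
    fun t => continuous_segmentAverage (X := ℝ)
      (h.continuous_density.comp (continuous_const.prodMk continuous_snd))
      continuous_const continuous_id
  have hG : Continuous fun p : ℝ × ℝ => 2 * segmentAverage (ux p.2) (q p.2) p.1 *
      (u p.2 (q p.2 + p.1) - ux p.2 (q p.2 + p.1)) := by
    refine ((continuous_segmentAverage (X := ℝ × ℝ) ?_ (hq.continuous.comp continuous_snd)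
      continuous_fst).const_mul 2).mul ?_
    · exact h.continuous_ux.comp ((continuous_snd.comp continuous_fst).prodMk continuous_snd)
    · exact h.continuous_density.comp (continuous_snd.prodMk
        ((hq.continuous.comp continuous_snd).add continuous_fst))
  -- Both sides are continuous in d, so it is enough to divide by d at d ≠ 0; the value at d = 0 is
  -- the claim.
  have hext : (fun d => segmentAverage (fun y => u t y - ux t y) (q t) d) =
      fun d => segmentAverage (fun y => u 0 y - ux 0 y) (q 0) d +
        ∫ s in (0 : ℝ)..t, 2 * segmentAverage (ux s) (q s) d *
          (u s (q s + d) - ux s (q s + d)) := by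
    refine Continuous.ext_on (dense_compl_singleton (0 : ℝ)) (hfix t) ((hfix 0).add
      (intervalIntegral.continuous_parametric_intervalIntegral_of_continuous' hG 0 t)) ?_
    intro d hd
    have hd0 : d ≠ 0 := hd
    have hder : ∀ s ∈ Ioo 0 t, HasDerivAt
        (fun s => potential u ux s (q s + d) - potential u ux s (q s))
        (d * (2 * segmentAverage (ux s) (q s) d * (u s (q s + d) - ux s (q s + d)))) s := by
      intro s hs
      have hs' : s ∈ Ioo 0 τ := ⟨hs.1, hs.2.trans_le ht.2⟩
      refine ((h.hasDerivAt_potential_comp hs' ((hq.hasDerivAt s hs').add_const d)).fun_sub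
        (h.hasDerivAt_potential_comp hs' (hq.hasDerivAt s hs'))).congr_deriv ?_
      linear_combination 2 * (u s (q s + d) - ux s (q s + d)) *
        h.sub_eq_mul_segmentAverage s (q s) d
    have := intervalIntegral.integral_eq_sub_of_hasDerivAt_of_le ht.1
      ((h.continuous_potential.comp (continuous_id.prodMk
        (hq.continuous.add_const d))).fun_sub (h.continuous_potential.comp
          (continuous_id.prodMk hq.continuous))).continuousOn hder
      (((hG.comp (Continuous.prodMk_right d)).const_mul d).intervalIntegrable _ _)
    simp only [Function.comp_apply, id, h.potential_sub, intervalIntegral.integral_const_mul,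
      ← mul_segmentAverage] at this
    simp only
    apply mul_left_cancel₀ hd0
    linarith
  have := congrFun hext 0
  simpa [segmentAverage_zero] using this

/-- The property that `eˣ (u - u_x)` is nondecreasing in `x`, i.e. `u - u_xx ≥ 0`, propagates. -/
theorem monotone_exp_mul_density (h : IsTransportSolution τ u ux ut) (hτ : 0 ≤ τ)
    (h0 : Monotone fun x => Real.exp x * (u 0 x - ux 0 x)) :
    Monotone fun x => Real.exp x * (u τ x - ux τ x) := by
  -- In R = e^q p the factor e^q contributes -2u and p contributes 2 u_x; together they give -2p,
  -- hence the Riccati equation.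
  have hR : ∀ q, IsCharacteristic τ u q →
      ContinuousOn (fun t => Real.exp (q t) * (u t (q t) - ux t (q t))) (Icc 0 τ) ∧
      ∀ t ∈ Ioo 0 τ, HasDerivAt (fun t => Real.exp (q t) * (u t (q t) - ux t (q t)))
        (-2 * Real.exp (-q t) * (Real.exp (q t) * (u t (q t) - ux t (q t))) ^ 2) t := by
    intro q hq
    have hcd := h.continuous_density.comp (continuous_id.prodMk hq.continuous)
    refine ⟨(hq.continuous.rexp.mul hcd).continuousOn, fun t ht => ?_⟩
    have hc : Continuous fun s => 2 * ux s (q s) * (u s (q s) - ux s (q s)) :=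
      ((h.continuous_ux.comp (continuous_id.prodMk hq.continuous)).const_mul 2).mul hcd
    have hp : HasDerivAt (fun t => u t (q t) - ux t (q t))
        (2 * ux t (q t) * (u t (q t) - ux t (q t))) t := by
      have h1 : HasDerivAt (fun t => u 0 (q 0) - ux 0 (q 0) +
          ∫ s in (0 : ℝ)..t, 2 * ux s (q s) * (u s (q s) - ux s (q s)))
          (2 * ux t (q t) * (u t (q t) - ux t (q t))) t :=
        (intervalIntegral.integral_hasDerivAt_right (hc.intervalIntegrable _ _)
          (hc.stronglyMeasurableAtFilter _ _) hc.continuousAt).const_add _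
      refine h1.congr_of_eventuallyEq ?_
      filter_upwards [Icc_mem_nhds ht.1 ht.2] with s hs
      exact h.density_characteristic hq hs
    refine ((hq.hasDerivAt t ht).exp.fun_mul hp).congr_deriv ?_
    have he : Real.exp (-q t) * Real.exp (q t) = 1 := by rw [← Real.exp_add]; simp
    linear_combination 2 * Real.exp (q t) * (u t (q t) - ux t (q t)) ^ 2 * he
  intro x y hxy
  obtain ⟨q, hq, rfl⟩ := h.exists_characteristic hτ x
  obtain ⟨r, hr, rfl⟩ := h.exists_characteristic hτ y
  have hqr : ∀ t ∈ Icc 0 τ, q t ≤ r t := fun t ht => h.characteristic_le hq hr hxy ht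
  have hcq := h.continuous_density.comp (continuous_id.prodMk hq.continuous)
  have hcr := h.continuous_density.comp (continuous_id.prodMk hr.continuous)
  -- For q ≤ r, e^{-q} ≥ e^{-r} gives (R_r - R_q)' ≥ -2 e^{-r} (R_r² - R_q²), and factoring the
  -- difference of squares yields the coefficient a.
  have key := le_exp_integral_mul_of_neg_mul_le_deriv
    (a := fun t => 2 * Real.exp (-r t) * (Real.exp (r t) * (u t (r t) - ux t (r t)) +
      Real.exp (q t) * (u t (q t) - ux t (q t)))) hτ
    ((hr.continuous.neg.rexp.const_mul 2).mul
      ((hr.continuous.rexp.mul hcr).add (hq.continuous.rexp.mul hcq)))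
    ((hR r hr).1.sub (hR q hq).1) (fun t ht => ((hR r hr).2 t ht).sub ((hR q hq).2 t ht)) (by
      intro t ht
      have he : Real.exp (-r t) ≤ Real.exp (-q t) :=
        Real.exp_le_exp.2 (neg_le_neg (hqr t (Ioo_subset_Icc_self ht)))
      simp only [Pi.sub_apply]
      nlinarith [mul_le_mul_of_nonneg_right he
        (sq_nonneg (Real.exp (q t) * (u t (q t) - ux t (q t))))])
  have hinit := h0 (hqr 0 (left_mem_Icc.2 hτ))
  simp only [Pi.sub_apply] at key hinit ⊢
  have := nonneg_of_mul_nonneg_right ((sub_nonneg.2 hinit).trans key) (Real.exp_pos _)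
  linarith

end IsTransportSolution

/-! ### Bounded functions with f - f'' ≥ 0. -/

section Static

variable {f f' : ℝ → ℝ} {M : ℝ}

/-- The subtracted term is the value that would arise if e^y (f - f') were constantly c. Comparing a
nondecreasing e^y (f - f') with its value c at x then fixes the sign of the derivative on either
side of x. -/
theorem hasDerivAt_exp_neg_mul_sub (hf : ∀ x, HasDerivAt f (f' x) x) (c y : ℝ) :
    HasDerivAt (fun y => Real.exp (-y) * f y - c * Real.exp (-2 * y) / 2)
      (Real.exp (-2 * y) * (c - Real.exp y * (f y - f' y))) y := by
  have h1 : HasDerivAt (fun y : ℝ => Real.exp (-y)) (-Real.exp (-y)) y := by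
    simpa using (hasDerivAt_neg y).exp
  have h2 : HasDerivAt (fun y : ℝ => Real.exp (-2 * y)) (Real.exp (-2 * y) * (-2 * 1)) y :=
    ((hasDerivAt_id' y).const_mul (-2)).exp
  refine ((h1.fun_mul (hf y)).fun_sub ((h2.const_mul c).div_const 2)).congr_deriv ?_
  have he : Real.exp (-2 * y) * Real.exp y = Real.exp (-y) := by
    rw [← Real.exp_add]; congr 1; ring
  linear_combination (f y - f' y) * he

/-- If `f` is bounded and `f - f'' ≥ 0` then `f' ≤ f`. -/
theorem deriv_le_self_of_monotone (hf : ∀ x, HasDerivAt f (f' x) x) (hM : ∀ x, |f x| ≤ M)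
    (hmono : Monotone fun x => Real.exp x * (f x - f' x)) (x : ℝ) : f' x ≤ f x := by
  by_contra! hlt
  set c := Real.exp x * (f x - f' x) with hc
  have hc0 : c < 0 := mul_neg_of_pos_of_neg (Real.exp_pos x) (by linarith)
  -- If c < 0, then H is nondecreasing on (-∞, x], hence bounded above there, yet its term -c
  -- e^{-2y}/2 dominates as y → -∞.
  set H : ℝ → ℝ := fun y => Real.exp (-y) * f y - c * Real.exp (-2 * y) / 2 with hH
  have hHm : MonotoneOn H (Iic x) := by
    refine monotoneOn_of_hasDerivWithinAt_nonneg (convex_Iic x)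
      (fun y _ => (hasDerivAt_exp_neg_mul_sub hf c y).continuousAt.continuousWithinAt)
      (fun y _ => (hasDerivAt_exp_neg_mul_sub hf c y).hasDerivWithinAt) ?_
    intro y hy
    rw [interior_Iic] at hy
    exact mul_nonneg (Real.exp_pos _).le (sub_nonneg.2 (hmono (le_of_lt hy)))
  -- N is chosen so that e^{-y} ≥ 1 - y ≥ N + 1 at y = min x (-N) already violates H y ≤ H x.
  set N : ℝ := 2 * (M + |H x| * Real.exp x) / (-c) with hN
  set y := min x (-N)
  have hyx : y ≤ x := min_le_left _ _
  have hyN : y ≤ -N := min_le_right _ _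
  have h1 : H y ≤ H x := hHm hyx self_mem_Iic hyx
  have h2 : Real.exp (-y) * f y ≥ Real.exp (-y) * (-M) :=
    mul_le_mul_of_nonneg_left (neg_le_of_abs_le (hM y)) (Real.exp_pos _).le
  have h3 : Real.exp (-2 * y) = Real.exp (-y) * Real.exp (-y) := by
    rw [← Real.exp_add]; congr 1; ring
  have h4 : 1 - y ≤ Real.exp (-y) := by linarith [Real.add_one_le_exp (-y)]
  have h5 : Real.exp (-y) * Real.exp y = 1 := by rw [← Real.exp_add]; simp
  have h6 : Real.exp y ≤ Real.exp x := Real.exp_le_exp.2 hyx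
  have h7 : H x ≤ Real.exp (-y) * (|H x| * Real.exp x) := by
    calc H x ≤ |H x| := le_abs_self _
      _ = Real.exp (-y) * (|H x| * Real.exp y) := by rw [mul_left_comm, h5, mul_one]
      _ ≤ _ := by gcongr
  have h8 : N * (-c) = 2 * (M + |H x| * Real.exp x) := by
    rw [hN, div_mul_cancel₀ _ (neg_pos.2 hc0).ne']
  have h9 : Real.exp (-y) * (-M + -c * Real.exp (-y) / 2) ≤
      Real.exp (-y) * (|H x| * Real.exp x) := by
    have : H y = Real.exp (-y) * f y - c * (Real.exp (-y) * Real.exp (-y)) / 2 := by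
      rw [← h3]
    nlinarith
  have h10 := le_of_mul_le_mul_left h9 (Real.exp_pos _)
  nlinarith [mul_le_mul_of_nonneg_left (show N + 1 ≤ Real.exp (-y) by linarith)
    (neg_nonneg.2 hc0.le)]

/-- If `f` is bounded and `f - f'' ≥ 0` then `-f ≤ f'`. -/
theorem neg_le_deriv_of_monotone (hf : ∀ x, HasDerivAt f (f' x) x) (hM : ∀ x, |f x| ≤ M)
    (hmono : Monotone fun x => Real.exp x * (f x - f' x)) (x : ℝ) : -f x ≤ f' x := by
  set c := Real.exp x * (f x - f' x) with hc
  set H : ℝ → ℝ := fun y => Real.exp (-y) * f y - c * Real.exp (-2 * y) / 2 with hH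
  have hHa : AntitoneOn H (Ici x) := by
    refine antitoneOn_of_hasDerivWithinAt_nonpos (convex_Ici x)
      (fun y _ => (hasDerivAt_exp_neg_mul_sub hf c y).continuousAt.continuousWithinAt)
      (fun y _ => (hasDerivAt_exp_neg_mul_sub hf c y).hasDerivWithinAt) ?_
    intro y hy
    rw [interior_Ici] at hy
    exact mul_nonpos_of_nonneg_of_nonpos (Real.exp_pos _).le
      (sub_nonpos.2 (hmono (le_of_lt hy)))
  have hlim : Tendsto H atTop (𝓝 0) := by
    have he : Tendsto (fun y : ℝ => Real.exp (-y)) atTop (𝓝 0) :=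
      Real.tendsto_exp_neg_atTop_nhds_zero
    have h1 : Tendsto (fun y => Real.exp (-y) * f y) atTop (𝓝 0) := by
      refine squeeze_zero_norm (a := fun y => Real.exp (-y) * M) (fun y => ?_)
        (by simpa using he.mul_const M)
      rw [norm_mul, Real.norm_eq_abs, Real.norm_eq_abs, abs_of_pos (Real.exp_pos _)]
      exact mul_le_mul_of_nonneg_left (hM y) (Real.exp_pos _).le
    have h2 : Tendsto (fun y : ℝ => c * Real.exp (-2 * y) / 2) atTop (𝓝 0) := by
      have : ∀ y : ℝ, c * Real.exp (-2 * y) / 2 = c / 2 * (Real.exp (-y) * Real.exp (-y)) := by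
        intro y
        rw [← Real.exp_add, show -y + -y = -2 * y by ring]
        ring
      simp_rw [this]
      simpa using (he.mul he).const_mul (c / 2)
    have h3 := h1.sub h2
    rwa [sub_zero] at h3
  -- H decreases to its limit 0 at +∞, so H x ≥ 0; with this c, H x equals e^{-x} (f x + f' x)/2.
  have h0 : 0 ≤ H x := by
    refine le_of_tendsto hlim ?_
    filter_upwards [eventually_ge_atTop x] with y hy
    exact hHa self_mem_Ici hy hy
  have h3 : Real.exp (-2 * x) = Real.exp (-x) * Real.exp (-x) := by
    rw [← Real.exp_add]; congr 1; ring
  have h5 : Real.exp (-x) * Real.exp x = 1 := by rw [← Real.exp_add]; simp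
  have h6 : H x = Real.exp (-x) * ((f x + f' x) / 2) := by
    simp only [hH, hc, h3]
    linear_combination (-(f x - f' x) / 2) * Real.exp (-x) * h5
  rw [h6] at h0
  have := nonneg_of_mul_nonneg_right h0 (Real.exp_pos _)
  linarith

end Static

/-! ### From distributional positivity to monotonicity of e^x (f - f'). -/

theorem MomentumNonneg.congr {f g : ℝ → ℝ} (h : MomentumNonneg f) (hfg : g =ᵐ[volume] f) :
    MomentumNonneg g := by
  intro φ h1 h2 h3
  refine (h φ h1 h2 h3).trans_eq (integral_congr_ae ?_)
  filter_upwards [hfg] with x hx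
  rw [hx]

open ContinuousLinearMap in
/-- A `C¹` function with `f - f'' ≥ 0` in the sense of distributions. -/
theorem MomentumNonneg.monotone {f f' : ℝ → ℝ} (h : MomentumNonneg f)
    (hf : ∀ x, HasDerivAt f (f' x) x) (hf' : Continuous f') :
    Monotone fun x => Real.exp x * (f x - f' x) := by
  have hfc : Continuous f := continuous_iff_continuousAt.2 fun x => (hf x).continuousAt
  -- Mollification: with f_n = ρ_n ∗ f the derivative of e^x (f_n - f_n') is e^x (f_n - f_n''),
  -- which is the hypothesis tested against ρ_n(x - ·). Monotonicity then passes to the pointwise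
  -- limit.
  let b : ℕ → ContDiffBump (0 : ℝ) := fun n =>
    ⟨1 / (n + 1) / 2, 1 / (n + 1), by positivity, half_lt_self (by positivity)⟩
  have hb : Tendsto (fun n => (b n).rOut) atTop (𝓝 0) := tendsto_one_div_add_atTop_nhds_zero_nat
  let ρ : ℕ → ℝ → ℝ := fun n => (b n).normed volume
  have hρ : ∀ n, ContDiff ℝ ∞ (ρ n) := fun n => (b n).contDiff_normed
  have hρc : ∀ n, HasCompactSupport (ρ n) := fun n => (b n).hasCompactSupport_normed
  have hρ' : ∀ n, ContDiff ℝ ∞ (deriv (ρ n)) := fun n =>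
    ((contDiff_infty_iff_deriv).1 (hρ n)).2
  have hparts : ∀ n x, convolution (deriv (ρ n)) f (lsmul ℝ ℝ) volume x =
      convolution (ρ n) f' (lsmul ℝ ℝ) volume x := by
    intro n x
    simp only [convolution_def, lsmul_apply, smul_eq_mul]
    have hd : ∀ t, HasDerivAt (fun t => f (x - t)) (-f' (x - t)) t := fun t =>
      ((hf (x - t)).comp t ((hasDerivAt_id' t).const_sub x)).congr_deriv (by ring)
    have hρd : ∀ t, HasDerivAt (ρ n) (deriv (ρ n) t) t := fun t =>
      ((hρ n).differentiable (by simp) t).hasDerivAt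
    have hcx : Continuous fun t => x - t := continuous_const.sub continuous_id
    have := integral_mul_deriv_eq_deriv_mul_of_integrable (u := ρ n) (v := fun t => f (x - t))
      (fun t _ => hρd t) (fun t _ => hd t)
      (((hρ n).continuous.mul (hf'.comp hcx).neg).integrable_of_hasCompactSupport
        (hρc n).mul_right)
      (((hρ' n).continuous.mul (hfc.comp hcx)).integrable_of_hasCompactSupport
        (hρc n).deriv.mul_right)
      (((hρ n).continuous.mul (hfc.comp hcx)).integrable_of_hasCompactSupport
        (hρc n).mul_right)
    simp only [mul_neg, integral_neg] at this
    linarith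
  have hmono : ∀ n, Monotone fun x => Real.exp x *
      (convolution (ρ n) f (lsmul ℝ ℝ) volume x -
        convolution (deriv (ρ n)) f (lsmul ℝ ℝ) volume x) := by
    intro n
    have hd : ∀ x, HasDerivAt (fun x => Real.exp x *
        (convolution (ρ n) f (lsmul ℝ ℝ) volume x -
          convolution (deriv (ρ n)) f (lsmul ℝ ℝ) volume x))
        (Real.exp x * (convolution (ρ n) f (lsmul ℝ ℝ) volume x -
          convolution (deriv (deriv (ρ n))) f (lsmul ℝ ℝ) volume x)) x := by
      intro x
      have h1 := (hρc n).hasDerivAt_convolution_left (lsmul ℝ ℝ) ((hρ n).of_le (by simp))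
        (hfc.locallyIntegrable (μ := volume)) x
      have h2 := (hρc n).deriv.hasDerivAt_convolution_left (lsmul ℝ ℝ)
        ((hρ' n).of_le (by simp)) (hfc.locallyIntegrable (μ := volume)) x
      refine ((Real.hasDerivAt_exp x).fun_mul (h1.fun_sub h2)).congr_deriv ?_
      ring
    refine monotone_of_deriv_nonneg (fun x => (hd x).differentiableAt) fun x => ?_
    rw [(hd x).deriv]
    refine mul_nonneg (Real.exp_pos x).le ?_
    have hcx : Continuous fun t => x - t := continuous_const.sub continuous_id
    have hsub : ContDiff ℝ ∞ fun t => x - t := contDiff_const.sub contDiff_id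
    have hcs : ∀ g : ℝ → ℝ, HasCompactSupport g → HasCompactSupport fun y => g (x - y) :=
      fun g hg => hg.comp_homeomorph (Homeomorph.subLeft x)
    have h0 := h (fun y => ρ n (x - y)) ((hρ n).comp hsub) (hcs _ (hρc n))
      (fun y => (b n).nonneg_normed _)
    have hit : ∀ y, iteratedDeriv 2 (fun y => ρ n (x - y)) y = deriv (deriv (ρ n)) (x - y) := by
      intro y
      rw [iteratedDeriv_succ, iteratedDeriv_one]
      have : deriv (fun y => ρ n (x - y)) = fun y => -deriv (ρ n) (x - y) :=
        funext fun y => deriv_comp_const_sub _ _ _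
      rw [this, deriv.fun_neg, deriv_comp_const_sub, neg_neg]
    refine h0.trans_eq ?_
    rw [convolution_lsmul_swap, convolution_lsmul_swap, ← integral_sub]
    · refine integral_congr_ae (Eventually.of_forall fun y => ?_)
      simp only [hit, smul_eq_mul]
      ring
    · exact (((hρ n).continuous.comp hcx).smul hfc).integrable_of_hasCompactSupport
        (hcs _ (hρc n)).smul_right
    · exact ((((hρ' n).continuous_deriv (by simp)).comp hcx).smul
        hfc).integrable_of_hasCompactSupport (hcs _ (hρc n).deriv.deriv).smul_right
  have hlim : ∀ x, Tendsto (fun n => Real.exp x *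
      (convolution (ρ n) f (lsmul ℝ ℝ) volume x -
        convolution (deriv (ρ n)) f (lsmul ℝ ℝ) volume x)) atTop
      (𝓝 (Real.exp x * (f x - f' x))) := by
    intro x
    simp only [hparts]
    exact ((ContDiffBump.convolution_tendsto_right_of_continuous hb hfc x).sub
      (ContDiffBump.convolution_tendsto_right_of_continuous hb hf' x)).const_mul _
  intro x y hxy
  exact le_of_tendsto_of_tendsto' (hlim x) (hlim y) fun n => hmono n hxy

/-! ### The nonlocal operator as a resolvent of 1 - ∂ₓ. -/

namespace SpatialDomain

theorem greenDeriv_circle_of_mem_Ioo {x : ℝ} (hx : x ∈ Ioo (-1 : ℝ) 0) :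
    circle.greenDeriv x = Real.sinh (x + 1 / 2) / (2 * Real.sinh (1 / 2)) := by
  have h0 : ⌊x⌋ = -1 := Int.floor_eq_iff.2 (by constructor <;> push_cast <;> linarith [hx.1, hx.2])
  simp only [greenDeriv, h0]
  push_cast
  congr 2
  ring

theorem periodic_greenDeriv_circle : Function.Periodic circle.greenDeriv 1 := by
  intro x
  simp only [greenDeriv, Int.floor_add_one]
  push_cast
  congr 2
  ring

/-- Integrating by parts moves the derivative from f to the kernel, where sinh + cosh = exp; the
jump of the kernel produces -f. The prefactor is e^x / (1 - e^{-1}), the periodized form of the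
formula on the line. -/
theorem dxLambdaInv_circle {f f' : ℝ → ℝ} (hf : ∀ x, HasDerivAt f (f' x) x)
    (hf' : Continuous f') (hper : Function.Periodic f 1) (x : ℝ) :
    circle.dxLambdaInv (fun y => f y + f' y) x =
      Real.exp (x + 1 / 2) / (2 * Real.sinh (1 / 2)) * (∫ y in x..x + 1, Real.exp (-y) * f y) -
        f x := by
  have hfc : Continuous f := continuous_iff_continuousAt.2 fun x => (hf x).continuousAt
  have hper' : Function.Periodic f' 1 := by
    intro y
    have h1 : HasDerivAt (fun y => f (y + 1)) (f' (y + 1)) y := (hf (y + 1)).comp_add_const y 1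
    rw [show (fun y => f (y + 1)) = f from funext hper] at h1
    exact h1.unique (hf y)
  have hperG : Function.Periodic (fun y => circle.greenDeriv (x - y) * (f y + f' y)) 1 := by
    intro y
    simp only [hper y, hper' y]
    congr 1
    have := periodic_greenDeriv_circle (x - (y + 1))
    rw [← this]
    congr 1
    ring
  have hs : Real.sinh (1 / 2) ≠ 0 := (Real.sinh_pos_iff.2 (by norm_num)).ne'
  have h1 : circle.dxLambdaInv (fun y => f y + f' y) x =
      ∫ y in x..x + 1, circle.greenDeriv (x - y) * (f y + f' y) := by
    rw [hperG.intervalIntegral_add_eq x 0]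
    simp only [dxLambdaInv, measure, carrier]
    rw [integral_Ico_eq_integral_Ioc, intervalIntegral.integral_of_le (by norm_num), zero_add]
  have h2 : ∫ y in x..x + 1, circle.greenDeriv (x - y) * (f y + f' y) =
      ∫ y in x..x + 1, Real.sinh (x - y + 1 / 2) / (2 * Real.sinh (1 / 2)) * (f y + f' y) := by
    rw [intervalIntegral.integral_of_le (by linarith), intervalIntegral.integral_of_le
      (by linarith), integral_Ioc_eq_integral_Ioo, integral_Ioc_eq_integral_Ioo]
    refine setIntegral_congr_fun measurableSet_Ioo fun y hy => ?_
    rw [greenDeriv_circle_of_mem_Ioo ⟨by linarith [hy.2], by linarith [hy.1]⟩]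
  have h3 : ∀ y, HasDerivAt (fun y => Real.sinh (x - y + 1 / 2) * f y)
      (Real.sinh (x - y + 1 / 2) * (f y + f' y) - Real.exp (x + 1 / 2) *
        (Real.exp (-y) * f y)) y := by
    intro y
    refine ((((hasDerivAt_id' y).const_sub x).add_const (1 / 2)).sinh.fun_mul
      (hf y)).congr_deriv ?_
    rw [← mul_assoc, ← Real.exp_add, show x + 1 / 2 + -y = x - y + 1 / 2 by ring,
      ← Real.sinh_add_cosh (x - y + 1 / 2)]
    ring
  have hc1 : Continuous fun y => Real.sinh (x - y + 1 / 2) * (f y + f' y) := by fun_prop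
  have hc2 : Continuous fun y => Real.exp (x + 1 / 2) * (Real.exp (-y) * f y) := by fun_prop
  have h4 := intervalIntegral.integral_eq_sub_of_hasDerivAt (a := x) (b := x + 1)
    (fun y _ => h3 y) ((hc1.sub hc2).intervalIntegrable _ _)
  rw [intervalIntegral.integral_sub (hc1.intervalIntegrable _ _) (hc2.intervalIntegrable _ _),
    intervalIntegral.integral_const_mul, hper x,
    show x - (x + 1) + 1 / 2 = -(1 / 2) by ring, show x - x + 1 / 2 = 1 / 2 by ring,
    Real.sinh_neg] at h4
  have h5 : ∀ y, Real.sinh (x - y + 1 / 2) / (2 * Real.sinh (1 / 2)) * (f y + f' y) =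
      (2 * Real.sinh (1 / 2))⁻¹ * (Real.sinh (x - y + 1 / 2) * (f y + f' y)) := by
    intro y
    ring
  rw [h1, h2]
  simp only [h5]
  rw [intervalIntegral.integral_const_mul, sub_eq_iff_eq_add.1 h4]
  field_simp
  ring

/-- The integrand left of x is a multiple of (e^y f)', which only leaves a boundary term; right of x
it is (e^{-y} f)' plus the term that survives. -/
theorem dxLambdaInv_line {f f' : ℝ → ℝ} (hf : ∀ x, HasDerivAt f (f' x) x)
    (hfi : Integrable f) (hfi' : Integrable f') (x : ℝ) :
    line.dxLambdaInv (fun y => f y + f' y) x =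
      Real.exp x * (∫ y in Ioi x, Real.exp (-y) * f y) - f x := by
  have hfc : Continuous f := continuous_iff_continuousAt.2 fun x => (hf x).continuousAt
  have hbot : Tendsto f atBot (𝓝 0) := tendsto_zero_of_hasDerivAt_of_integrableOn_Iic (a := 0)
    (fun y _ => hf y) hfi'.integrableOn hfi.integrableOn
  have htop : Tendsto f atTop (𝓝 0) := tendsto_zero_of_hasDerivAt_of_integrableOn_Ioi (a := 0)
    (fun y _ => hf y) hfi'.integrableOn hfi.integrableOn
  have hmulIic : ∀ g : ℝ → ℝ, Integrable g → IntegrableOn (fun y => Real.exp y * g y) (Iic x) := by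
    intro g hg
    refine hg.integrableOn.bdd_mul (c := Real.exp x) Real.continuous_exp.aestronglyMeasurable ?_
    filter_upwards [ae_restrict_mem measurableSet_Iic] with y hy
    rw [Real.norm_eq_abs, abs_of_pos (Real.exp_pos y)]
    exact Real.exp_le_exp.2 hy
  have hmulIoi : ∀ g : ℝ → ℝ, Integrable g →
      IntegrableOn (fun y => Real.exp (-y) * g y) (Ioi x) := by
    intro g hg
    refine hg.integrableOn.bdd_mul (c := Real.exp (-x))
      (Real.continuous_exp.comp continuous_neg).aestronglyMeasurable ?_
    filter_upwards [ae_restrict_mem measurableSet_Ioi] with y hy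
    rw [Real.norm_eq_abs, abs_of_pos (Real.exp_pos _)]
    exact Real.exp_le_exp.2 (neg_le_neg (le_of_lt hy))
  have hleft : ∫ y in Iic x, Real.exp y * (f y + f' y) = Real.exp x * f x := by
    have := integral_Iic_of_hasDerivAt_of_tendsto' (a := x) (m := 0)
      (f := fun y => Real.exp y * f y) (f' := fun y => Real.exp y * (f y + f' y))
      (fun y _ => ((Real.hasDerivAt_exp y).fun_mul (hf y)).congr_deriv (by ring))
      (hmulIic _ (hfi.add hfi')) (by simpa using Real.tendsto_exp_atBot.mul hbot)
    rw [this, sub_zero]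
  have hright : ∫ y in Ioi x, Real.exp (-y) * (f' y - f y) = -(Real.exp (-x) * f x) := by
    have h1 : ∀ y : ℝ, HasDerivAt (fun y : ℝ => Real.exp (-y)) (-Real.exp (-y)) y := fun y => by
      simpa using (hasDerivAt_neg y).exp
    have := integral_Ioi_of_hasDerivAt_of_tendsto' (a := x) (m := 0)
      (f := fun y => Real.exp (-y) * f y) (f' := fun y => Real.exp (-y) * (f' y - f y))
      (fun y _ => ((h1 y).fun_mul (hf y)).congr_deriv (by ring))
      (hmulIoi _ (hfi'.sub hfi))
      (by simpa using Real.tendsto_exp_neg_atTop_nhds_zero.mul htop)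
    rw [this, zero_sub]
  have hL : ∀ y ∈ Iio x, line.greenDeriv (x - y) * (f y + f' y) =
      -(Real.exp (-x) / 2) * (Real.exp y * (f y + f' y)) := by
    intro y hy
    have hy' : 0 < x - y := sub_pos.2 hy
    simp only [greenDeriv, sign_pos hy', abs_of_pos hy', SignType.coe_one]
    rw [show -(x - y) = -x + y by ring, Real.exp_add]
    ring
  have hR : ∀ y ∈ Ioi x, line.greenDeriv (x - y) * (f y + f' y) =
      Real.exp x / 2 * (Real.exp (-y) * (f' y - f y) + 2 * (Real.exp (-y) * f y)) := by
    intro y hy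
    have hy' : x - y < 0 := sub_neg.2 hy
    simp only [greenDeriv, sign_neg hy', abs_of_neg hy', SignType.coe_neg_one]
    rw [show -(-(x - y)) = x + -y by ring, Real.exp_add]
    ring
  have hIL : IntegrableOn (fun y => line.greenDeriv (x - y) * (f y + f' y)) (Iic x) := by
    rw [integrableOn_Iic_iff_integrableOn_Iio]
    exact (IntegrableOn.mono_set ((hmulIic _ (hfi.add hfi')).const_mul _)
      Iio_subset_Iic_self).congr_fun (fun y hy => (hL y hy).symm) measurableSet_Iio
  have hIR : IntegrableOn (fun y => line.greenDeriv (x - y) * (f y + f' y)) (Ioi x) :=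
    IntegrableOn.congr_fun (((hmulIoi _ (hfi'.sub hfi)).add
      ((hmulIoi _ hfi).const_mul 2)).const_mul _) (fun y hy => (hR y hy).symm) measurableSet_Ioi
  have h1 : line.dxLambdaInv (fun y => f y + f' y) x =
      (∫ y in Iic x, line.greenDeriv (x - y) * (f y + f' y)) +
        ∫ y in Ioi x, line.greenDeriv (x - y) * (f y + f' y) := by
    rw [intervalIntegral.integral_Iic_add_Ioi hIL hIR]
    simp [dxLambdaInv, measure, carrier]
  rw [h1, integral_Iic_eq_integral_Iio, setIntegral_congr_fun measurableSet_Iio hL,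
    setIntegral_congr_fun measurableSet_Ioi hR, integral_const_mul, integral_const_mul,
    ← integral_Iic_eq_integral_Iio, hleft, integral_add (hmulIoi (fun y => f' y - f y)
      (hfi'.sub hfi)) ((hmulIoi _ hfi).const_mul 2), integral_const_mul, hright]
  have he : Real.exp (-x) * Real.exp x = 1 := by rw [← Real.exp_add]; simp
  linear_combination (-f x) * he

/-- `(F + f)' = F` for `F = ∂ₓ Λ⁻² (f + f')`, on the circle. -/
theorem hasDerivAt_dxLambdaInv_circle {f f' : ℝ → ℝ} (hf : ∀ x, HasDerivAt f (f' x) x)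
    (hf' : Continuous f') (hper : Function.Periodic f 1) (x : ℝ) :
    HasDerivAt (fun x => circle.dxLambdaInv (fun y => f y + f' y) x + f x)
      (circle.dxLambdaInv (fun y => f y + f' y) x) x := by
  have hfc : Continuous f := continuous_iff_continuousAt.2 fun x => (hf x).continuousAt
  have hc : Continuous fun y => Real.exp (-y) * f y := by fun_prop
  have hs : Real.sinh (1 / 2) ≠ 0 := (Real.sinh_pos_iff.2 (by norm_num)).ne'
  have hprim : ∀ x, HasDerivAt (fun x => ∫ y in (0 : ℝ)..x, Real.exp (-y) * f y)
      (Real.exp (-x) * f x) x := fun x =>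
    intervalIntegral.integral_hasDerivAt_right (hc.intervalIntegrable _ _)
      (hc.stronglyMeasurableAtFilter _ _) hc.continuousAt
  have hsub : ∀ x, ∫ y in x..x + 1, Real.exp (-y) * f y =
      (∫ y in (0 : ℝ)..x + 1, Real.exp (-y) * f y) - ∫ y in (0 : ℝ)..x, Real.exp (-y) * f y :=
    fun x => (intervalIntegral.integral_interval_sub_left (hc.intervalIntegrable _ _)
      (hc.intervalIntegrable _ _)).symm
  simp only [dxLambdaInv_circle hf hf' hper, sub_add_cancel, hsub]
  refine (((((hasDerivAt_id' x).add_const (1 / 2)).exp.div_const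
    (2 * Real.sinh (1 / 2))).fun_mul
      (((hprim (x + 1)).comp_add_const x 1).fun_sub (hprim x)))).congr_deriv ?_
  rw [hper x]
  have h1 : Real.exp (x + 1 / 2) * Real.exp (-(x + 1)) = Real.exp (-(1 / 2)) := by
    rw [← Real.exp_add]; congr 1; ring
  have h2 : Real.exp (x + 1 / 2) * Real.exp (-x) = Real.exp (1 / 2) := by
    rw [← Real.exp_add]; congr 1; ring
  have h3 := Real.sinh_eq (1 / 2)
  have h4 : (2 * Real.sinh (1 / 2))⁻¹ * (2 * Real.sinh (1 / 2)) = 1 :=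
    inv_mul_cancel₀ (mul_ne_zero two_ne_zero hs)
  linear_combination (2 * Real.sinh (1 / 2))⁻¹ * f x * (h1 - h2 + 2 * h3) - f x * h4

/-- `(F + f)' = F` for `F = ∂ₓ Λ⁻² (f + f')`, on the line. -/
theorem hasDerivAt_dxLambdaInv_line {f f' : ℝ → ℝ} (hf : ∀ x, HasDerivAt f (f' x) x)
    (hfi : Integrable f) (hfi' : Integrable f') (x : ℝ) :
    HasDerivAt (fun x => line.dxLambdaInv (fun y => f y + f' y) x + f x)
      (line.dxLambdaInv (fun y => f y + f' y) x) x := by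
  have hfc : Continuous f := continuous_iff_continuousAt.2 fun x => (hf x).continuousAt
  have hc : Continuous fun y => Real.exp (-y) * f y := by fun_prop
  have hint : ∀ x, IntegrableOn (fun y => Real.exp (-y) * f y) (Ioi x) := by
    intro x
    refine hfi.integrableOn.bdd_mul (c := Real.exp (-x))
      (Real.continuous_exp.comp continuous_neg).aestronglyMeasurable ?_
    filter_upwards [ae_restrict_mem measurableSet_Ioi] with y hy
    rw [Real.norm_eq_abs, abs_of_pos (Real.exp_pos _)]
    exact Real.exp_le_exp.2 (neg_le_neg (le_of_lt hy))
  have hsub : ∀ x, ∫ y in Ioi x, Real.exp (-y) * f y =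
      (∫ y in Ioi 0, Real.exp (-y) * f y) - ∫ y in (0 : ℝ)..x, Real.exp (-y) * f y := by
    intro x
    rw [← intervalIntegral.integral_Ioi_sub_Ioi' (hint 0) (hint x)]
    ring
  have hprim : HasDerivAt (fun x => ∫ y in (0 : ℝ)..x, Real.exp (-y) * f y)
      (Real.exp (-x) * f x) x :=
    intervalIntegral.integral_hasDerivAt_right (hc.intervalIntegrable _ _)
      (hc.stronglyMeasurableAtFilter _ _) hc.continuousAt
  simp only [dxLambdaInv_line hf hfi hfi', sub_add_cancel]
  rw [funext fun x => congrArg (Real.exp x * ·) (hsub x), hsub x]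
  refine ((Real.hasDerivAt_exp x).fun_mul (hprim.const_sub _)).congr_deriv ?_
  have he : Real.exp x * Real.exp (-x) = 1 := by rw [← Real.exp_add]; simp
  linear_combination (-f x) * he

end SpatialDomain

/-! ### Weak derivatives and the Sobolev embedding on the line. -/

section Sobolev

variable {f f' D : ℝ → ℝ}

theorem IsWeakDeriv.ae_eq_of_zero (h : IsWeakDeriv 0 f D) : f =ᵐ[volume] D := by
  refine ae_eq_of_integral_contDiff_smul_eq h.1 h.2.1 fun g hg hgc => ?_
  have := h.2.2 g hg hgc
  simpa [mul_comm] using this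

theorem IsWeakDeriv.ae_eq_of_one (h : IsWeakDeriv 1 f D) (hf : ∀ x, HasDerivAt f (f' x) x)
    (hf' : Continuous f') : f' =ᵐ[volume] D := by
  have hfc : Continuous f := continuous_iff_continuousAt.2 fun x => (hf x).continuousAt
  refine ae_eq_of_integral_contDiff_smul_eq hf'.locallyIntegrable h.2.1 fun g hg hgc => ?_
  have h1 := h.2.2 g hg hgc
  have hgd : ∀ x, HasDerivAt g (deriv g x) x := fun x =>
    (hg.differentiable (by simp) x).hasDerivAt
  have h2 := integral_mul_deriv_eq_deriv_mul_of_integrable (u := f) (v := g)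
    (fun x _ => hf x) (fun x _ => hgd x)
    ((hfc.mul (hg.continuous_deriv (by simp))).integrable_of_hasCompactSupport hgc.deriv.mul_left)
    ((hf'.mul hg.continuous).integrable_of_hasCompactSupport hgc.mul_left)
    ((hfc.mul hg.continuous).integrable_of_hasCompactSupport hgc.mul_left)
  simp only [iteratedDeriv_one, pow_one, neg_mul, one_mul] at h1
  simp only [smul_eq_mul, mul_comm (g _)]
  linarith

/-- The `H¹` norm of a `C¹` function is bounded by its `Hⁿ` norm, `n ≥ 1`. -/
theorem eLpNorm_le_sobolevNorm_line {n : ℕ} (hn : 1 ≤ n) (hf : ∀ x, HasDerivAt f (f' x) x)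
    (hf' : Continuous f') :
    (eLpNorm f 2 volume ^ 2 + eLpNorm f' 2 volume ^ 2) ^ (1 / 2 : ℝ) ≤
      sobolevNorm SpatialDomain.line n f := by
  refine le_iInf₂ fun D hD => ENNReal.rpow_le_rpow ?_ (by norm_num)
  have h0 := (hD 0 (by omega)).ae_eq_of_zero
  have h1 := (hD 1 hn).ae_eq_of_one hf hf'
  have hm : SpatialDomain.line.measure = volume := by
    simp [SpatialDomain.measure, SpatialDomain.carrier]
  rw [eLpNorm_congr_ae h0, eLpNorm_congr_ae h1, hm]
  calc eLpNorm (D 0) 2 volume ^ 2 + eLpNorm (D 1) 2 volume ^ 2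
      = ∑ k ∈ Finset.range 2, eLpNorm (D k) 2 volume ^ 2 := by simp [Finset.sum_range_succ]
    _ ≤ ∑ k ∈ Finset.range (n + 1), eLpNorm (D k) 2 volume ^ 2 :=
      Finset.sum_le_sum_of_subset (Finset.range_mono (by omega))

theorem memLp_of_sobolevNorm_line_lt_top {n : ℕ} (hn : 1 ≤ n)
    (hf : ∀ x, HasDerivAt f (f' x) x) (hf' : Continuous f')
    (h : sobolevNorm SpatialDomain.line n f < ⊤) : MemLp f 2 volume ∧ MemLp f' 2 volume := by
  have hfc : Continuous f := continuous_iff_continuousAt.2 fun x => (hf x).continuousAt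
  have h1 := (eLpNorm_le_sobolevNorm_line hn hf hf').trans_lt h
  rw [ENNReal.rpow_lt_top_iff_of_pos (by norm_num), ENNReal.add_lt_top] at h1
  exact ⟨⟨hfc.aestronglyMeasurable, by simpa using h1.1⟩,
    ⟨hf'.aestronglyMeasurable, by simpa using h1.2⟩⟩

/-- Since f² vanishes at +∞, f(x)² = -∫_x^∞ 2 f f', and -2ab ≤ a² + b². -/
theorem sq_le_integral_sq_add_sq (hf : ∀ x, HasDerivAt f (f' x) x) (h0 : MemLp f 2 volume)
    (h1 : MemLp f' 2 volume) (x : ℝ) : f x ^ 2 ≤ ∫ y, (f y ^ 2 + f' y ^ 2) := by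
  have i0 : Integrable fun y => f y ^ 2 := h0.integrable_sq
  have i1 : Integrable fun y => f' y ^ 2 := h1.integrable_sq
  have i2 : Integrable fun y => 2 * f y * f' y := by
    simpa [mul_assoc] using (h0.integrable_mul h1).const_mul 2
  have hd : ∀ y, HasDerivAt (fun y => f y ^ 2) (2 * f y * f' y) y := fun y =>
    ((hf y).fun_pow 2).congr_deriv (by simp)
  have htop : Tendsto (fun y => f y ^ 2) atTop (𝓝 0) :=
    tendsto_zero_of_hasDerivAt_of_integrableOn_Ioi (a := 0) (fun y _ => hd y)
      i2.integrableOn i0.integrableOn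
  have h2 := integral_Ioi_of_hasDerivAt_of_tendsto' (a := x) (fun y _ => hd y)
    i2.integrableOn htop
  calc f x ^ 2 = ∫ y in Ioi x, -(2 * f y * f' y) := by rw [integral_neg, h2]; ring
    _ ≤ ∫ y in Ioi x, (f y ^ 2 + f' y ^ 2) := by
      refine integral_mono i2.integrableOn.neg (i0.add i1).integrableOn fun y => ?_
      simp only
      nlinarith [sq_nonneg (f y + f' y)]
    _ ≤ ∫ y, (f y ^ 2 + f' y ^ 2) :=
      setIntegral_le_integral (i0.add i1) (Eventually.of_forall fun y => by positivity)

/-- The Sobolev embedding `Hⁿ(ℝ) ⊆ L^∞(ℝ)` for `C¹` functions. -/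
theorem ofReal_abs_le_sobolevNorm_line {n : ℕ} (hn : 1 ≤ n) (hf : ∀ x, HasDerivAt f (f' x) x)
    (hf' : Continuous f') (x : ℝ) :
    ENNReal.ofReal |f x| ≤ sobolevNorm SpatialDomain.line n f := by
  rcases eq_top_or_lt_top (sobolevNorm SpatialDomain.line n f) with h | h
  · rw [h]; exact le_top
  obtain ⟨h0, h1⟩ := memLp_of_sobolevNorm_line_lt_top hn hf hf' h
  refine le_trans ?_ (eLpNorm_le_sobolevNorm_line hn hf hf')
  have hsq : ∀ g : ℝ → ℝ, MemLp g 2 volume →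
      eLpNorm g 2 volume ^ 2 = ENNReal.ofReal (∫ y, g y ^ 2) := by
    intro g hg
    have := eLpNorm_nnreal_pow_eq_lintegral (μ := (volume : Measure ℝ)) (f := g) (p := 2)
      two_ne_zero
    rw [ofReal_integral_eq_lintegral_ofReal hg.integrable_sq
      (Eventually.of_forall fun y => sq_nonneg _)]
    simp only [NNReal.coe_ofNat, ENNReal.rpow_ofNat, ENNReal.coe_ofNat] at this
    rw [this]
    refine lintegral_congr fun y => ?_
    rw [Real.enorm_eq_ofReal_abs, ← ENNReal.ofReal_pow (abs_nonneg _), sq_abs]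
  rw [hsq f h0, hsq f' h1, ← ENNReal.ofReal_add (integral_nonneg fun y => sq_nonneg _)
    (integral_nonneg fun y => sq_nonneg _), ← integral_add h0.integrable_sq h1.integrable_sq,
    ENNReal.ofReal_rpow_of_nonneg (integral_nonneg fun y => by positivity) (by norm_num),
    ← Real.sqrt_eq_rpow]
  exact ENNReal.ofReal_le_ofReal (Real.abs_le_sqrt (sq_le_integral_sq_add_sq hf h0 h1 x))

end Sobolev

/-! ### Upper bounds of u from the conserved mass. -/

namespace IsTransportSolution

variable {τ : ℝ} {u ux ut : ℝ → ℝ → ℝ} {M : ℝ}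

theorem abs_deriv_le (h : IsTransportSolution τ u ux ut) (hτ : 0 ≤ τ)
    (h0 : Monotone fun x => Real.exp x * (u 0 x - ux 0 x)) (x : ℝ) : |ux τ x| ≤ u τ x := by
  obtain ⟨M, hM⟩ := h.bounded
  have hm := h.monotone_exp_mul_density hτ h0
  exact abs_le.2 ⟨neg_le_deriv_of_monotone (h.hasDerivAt_x τ) (hM τ) hm x,
    deriv_le_self_of_monotone (h.hasDerivAt_x τ) (hM τ) hm x⟩

/-- Because p ≥ 0, the function e^{q-y} u + U has derivative p (1 - e^{q-y}) ≥ 0 for y ≥ q.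
Conservation replaces the final mass by the initial one, whose u_x part integrates to boundary
values. -/
theorem le_exp_mul_add (h : IsTransportSolution τ u ux ut) (hτ : 0 ≤ τ)
    (h0 : Monotone fun x => Real.exp x * (u 0 x - ux 0 x)) {q r : ℝ → ℝ}
    (hq : IsCharacteristic τ u q) (hr : IsCharacteristic τ u r) (hqr : q τ ≤ r τ) :
    u τ (q τ) ≤ Real.exp (q τ - r τ) * u τ (r τ) +
      ((∫ y in q 0..r 0, u 0 y) - (u 0 (r 0) - u 0 (q 0))) := by
  have hx : ∀ t, Continuous (ux t) := fun t => h.continuous_ux.comp (Continuous.prodMk_right t)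
  have hu : ∀ t, Continuous (u t) := fun t => h.continuous.comp (Continuous.prodMk_right t)
  have hmass := h.integral_density_characteristic hτ hq hr
  rw [intervalIntegral.integral_sub (μ := volume) (f := u 0) ((hu 0).intervalIntegrable _ _)
    ((hx 0).intervalIntegrable _ _), intervalIntegral.integral_eq_sub_of_hasDerivAt
    (fun y _ => h.hasDerivAt_x 0 y) ((hx 0).intervalIntegrable _ _), ← h.potential_sub] at hmass
  have hd : ∀ y, HasDerivAt (fun y => Real.exp (q τ - y) * u τ y + potential u ux τ y)
      ((u τ y - ux τ y) * (1 - Real.exp (q τ - y))) y := fun y =>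
    (((((hasDerivAt_id' y).const_sub (q τ)).exp).fun_mul (h.hasDerivAt_x τ y)).fun_add
      (h.hasDerivAt_potential_x τ y)).congr_deriv (by ring)
  have hmono : MonotoneOn (fun y => Real.exp (q τ - y) * u τ y + potential u ux τ y)
      (Ici (q τ)) := by
    refine monotoneOn_of_hasDerivWithinAt_nonneg (convex_Ici _)
      (fun y _ => (hd y).continuousAt.continuousWithinAt)
      (fun y _ => (hd y).hasDerivWithinAt) fun y hy => ?_
    rw [interior_Ici] at hy
    refine mul_nonneg (sub_nonneg.2 (le_of_abs_le (h.abs_deriv_le hτ h0 y))) (sub_nonneg.2 ?_)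
    exact Real.exp_le_one_iff.2 (sub_nonpos.2 (le_of_lt hy))
  have := hmono self_mem_Ici hqr hqr
  simp only [sub_self, Real.exp_zero, one_mul] at this
  linarith

/-- The right endpoint is sent to +∞: boundedness of u at time τ kills the exponential term,
whatever the bound, and the initial mass is estimated uniformly. -/
theorem le_of_integrable (h : IsTransportSolution τ u ux ut) (hτ : 0 ≤ τ)
    (h0 : Monotone fun x => Real.exp x * (u 0 x - ux 0 x)) (hM : ∀ x, |u 0 x| ≤ M)
    (hint : Integrable (u 0)) (x : ℝ) : u τ x ≤ (∫ y, |u 0 y|) + 2 * M := by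
  obtain ⟨B, hB⟩ := h.bounded
  obtain ⟨q, hq, rfl⟩ := h.exists_characteristic hτ x
  have hle : ∀ b, q τ ≤ b →
      u τ (q τ) ≤ Real.exp (q τ - b) * B + ((∫ y, |u 0 y|) + 2 * M) := by
    intro b hb
    obtain ⟨r, hr, rfl⟩ := h.exists_characteristic hτ b
    have h1 := h.le_exp_mul_add hτ h0 hq hr hb
    have h2 : ∫ y in q 0..r 0, u 0 y ≤ ∫ y, |u 0 y| := by
      rw [intervalIntegral.integral_of_le (h.characteristic_le hq hr hb (left_mem_Icc.2 hτ))]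
      exact (integral_mono hint.integrableOn hint.abs.integrableOn fun y => le_abs_self _).trans
        (setIntegral_le_integral hint.abs (Eventually.of_forall fun y => abs_nonneg _))
    have h3 := mul_le_mul_of_nonneg_left (le_of_abs_le (hB τ (r τ)))
      (Real.exp_pos (q τ - r τ)).le
    linarith [neg_le_of_abs_le (hM (r 0)), le_of_abs_le (hM (q 0))]
  have hlim : Tendsto (fun b => Real.exp (q τ - b) * B + ((∫ y, |u 0 y|) + 2 * M)) atTop
      (𝓝 (0 * B + ((∫ y, |u 0 y|) + 2 * M))) := by
    refine Tendsto.add_const _ (Tendsto.mul_const _ ?_)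
    exact Real.tendsto_exp_atBot.comp (tendsto_atBot_add_const_left _ _ tendsto_neg_atTop_atBot)
  rw [zero_mul, zero_add] at hlim
  refine ge_of_tendsto hlim ?_
  filter_upwards [eventually_ge_atTop (q τ)] with b hb using hle b hb

/-- A characteristic shifted by one period is again a characteristic. Over a period the boundary
values cancel, and e^{-1} u is absorbed on the left. -/
theorem le_of_periodic (h : IsTransportSolution τ u ux ut) (hτ : 0 ≤ τ)
    (h0 : Monotone fun x => Real.exp x * (u 0 x - ux 0 x)) (hM : ∀ x, |u 0 x| ≤ M)
    (hper : ∀ t, Function.Periodic (u t) 1) (x : ℝ) : u τ x ≤ M / (1 - Real.exp (-1)) := by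
  obtain ⟨q, hq, rfl⟩ := h.exists_characteristic hτ x
  have hr : IsCharacteristic τ u fun t => q t + 1 :=
    ⟨hq.continuous.add_const 1, fun t ht => by
      simpa only [hper t (q t)] using (hq.hasDerivAt t ht).add_const 1⟩
  have h1 := h.le_exp_mul_add hτ h0 hq hr (by linarith)
  simp only [hper _ _, sub_self, sub_zero, sub_add_cancel_left] at h1
  have h2 := intervalIntegral.norm_integral_le_of_norm_le_const (a := q 0) (b := q 0 + 1)
    (f := u 0) (C := M) (fun y _ => hM y)
  rw [add_sub_cancel_left, abs_one, mul_one] at h2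
  have h3 : Real.exp (-1) < 1 := by simp
  rw [le_div_iff₀ (by linarith)]
  linarith [le_of_abs_le h2]

end IsTransportSolution

/-! ### Strong solutions as solutions of the conservation law. -/

theorem zero_mem_timeInterval {T : EReal} (hT : 0 < T) : (0 : ℝ) ∈ timeInterval T :=
  ⟨le_rfl, hT⟩

theorem Icc_subset_timeInterval {T : EReal} {τ : ℝ} (hτ : τ ∈ timeInterval T) :
    Icc 0 τ ⊆ timeInterval T := fun _ ht =>
  ⟨ht.1, (EReal.coe_le_coe_iff.2 ht.2).trans_lt hτ.2⟩

theorem uniqueDiffOn_timeInterval {T : EReal} (hT : 0 < T) :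
    UniqueDiffOn ℝ (timeInterval T) := by
  obtain ⟨ε, h0, h1⟩ := EReal.lt_iff_exists_real_btwn.1 hT
  have h0' : 0 < ε := EReal.coe_lt_coe_iff.1 h0
  refine uniqueDiffOn_convex ?_ ?_
  · refine OrdConnected.convex ⟨fun a ha b hb t ht => ?_⟩
    exact ⟨ha.1.trans ht.1, (EReal.coe_le_coe_iff.2 ht.2).trans_lt hb.2⟩
  · refine ⟨ε / 2, interior_mono (Icc_subset_timeInterval (τ := ε) ⟨h0'.le, h1⟩) ?_⟩
    rw [interior_Icc]
    constructor <;> linarith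

namespace IsStrongSolution

variable {K : SpatialDomain} {n : ℕ} {u₀ : ℝ → ℝ} {T : EReal} {u : ℝ → ℝ → ℝ}

/-- The partial derivatives of a strong solution exist and are continuous. -/
theorem exists_partials (h : IsStrongSolution K n u₀ T u) (hT : 0 < T) :
    ∃ ux ut : ℝ → ℝ → ℝ,
      ContinuousOn (fun p : ℝ × ℝ => ux p.1 p.2) (timeInterval T ×ˢ univ) ∧
      ContinuousOn (fun p : ℝ × ℝ => ut p.1 p.2) (timeInterval T ×ˢ univ) ∧
      (∀ t ∈ timeInterval T, ∀ x, HasDerivAt (u t) (ux t x) x) ∧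
      ∀ t ∈ timeInterval T, ∀ x,
        HasDerivWithinAt (fun s => u s x) (ut t x) (timeInterval T) t := by
  set S := timeInterval T
  have hS : UniqueDiffOn ℝ (S ×ˢ (univ : Set ℝ)) :=
    (uniqueDiffOn_timeInterval hT).prod uniqueDiffOn_univ
  have hc := h.contDiff.continuousOn_fderivWithin hS le_rfl
  have hd : ∀ p ∈ S ×ˢ (univ : Set ℝ), HasFDerivWithinAt (fun p : ℝ × ℝ => u p.1 p.2)
      (fderivWithin ℝ (fun p : ℝ × ℝ => u p.1 p.2) (S ×ˢ univ) p) (S ×ˢ univ) p := fun p hp =>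
    (h.contDiff.differentiableOn one_ne_zero p hp).hasFDerivWithinAt
  refine ⟨fun t x => fderivWithin ℝ (fun p : ℝ × ℝ => u p.1 p.2) (S ×ˢ univ) (t, x) (0, 1),
    fun t x => fderivWithin ℝ (fun p : ℝ × ℝ => u p.1 p.2) (S ×ˢ univ) (t, x) (1, 0),
    hc.clm_apply continuousOn_const, hc.clm_apply continuousOn_const, ?_, ?_⟩
  · intro t ht x
    have h1 : HasDerivWithinAt (fun y : ℝ => (t, y)) ((0 : ℝ), (1 : ℝ)) univ x :=
      ((hasDerivAt_const x t).prodMk (hasDerivAt_id x)).hasDerivWithinAt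
    exact hasDerivWithinAt_univ.1 ((hd (t, x) ⟨ht, mem_univ _⟩).comp_hasDerivWithinAt x h1
      fun y _ => ⟨ht, mem_univ _⟩)
  · intro t ht x
    have h1 : HasDerivWithinAt (fun s : ℝ => (s, x)) ((1 : ℝ), (0 : ℝ)) S t :=
      ((hasDerivAt_id t).prodMk (hasDerivAt_const t x)).hasDerivWithinAt
    exact (hd (t, x) ⟨ht, mem_univ _⟩).comp_hasDerivWithinAt t h1
      fun s hs => mk_mem_prod hs (mem_univ x)

theorem exists_bound_circle (h : IsStrongSolution SpatialDomain.circle n u₀ T u) {τ : ℝ}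
    (hτ : τ ∈ timeInterval T) : ∃ M, ∀ t ∈ Icc 0 τ, ∀ x, |u t x| ≤ M := by
  have hsub : Icc 0 τ ×ˢ Icc (0 : ℝ) 1 ⊆ timeInterval T ×ˢ univ :=
    prod_mono (Icc_subset_timeInterval hτ) (subset_univ _)
  obtain ⟨M, hM⟩ := (isCompact_Icc.prod isCompact_Icc).exists_bound_of_continuousOn
    (h.contDiff.continuousOn.mono hsub)
  refine ⟨M, fun t ht x => ?_⟩
  have hper : Function.Periodic (u t) 1 :=
    (h.continuous_sobolev.1 t (Icc_subset_timeInterval hτ ht)).1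
  obtain ⟨y, hy, hxy⟩ := hper.exists_mem_Ico₀ one_pos x
  rw [hxy]
  exact hM (t, y) ⟨ht, Ico_subset_Icc_self hy⟩

/-- By the Sobolev embedding, continuity in Hⁿ gives a bound uniform in x near each time;
compactness of [0, τ] makes it uniform in t. -/
theorem exists_bound_line (h : IsStrongSolution SpatialDomain.line n u₀ T u) (hn : 1 ≤ n)
    (hT : 0 < T) {τ : ℝ} (hτ : τ ∈ timeInterval T) :
    ∃ M, ∀ t ∈ Icc 0 τ, ∀ x, |u t x| ≤ M := by
  obtain ⟨ux, ut, hcx, -, hx, -⟩ := h.exists_partials hT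
  have hcx' : ∀ t ∈ timeInterval T, Continuous (ux t) := fun t ht =>
    hcx.comp_continuous (Continuous.prodMk_right t) fun x => ⟨ht, mem_univ x⟩
  refine isCompact_Icc.induction_on (p := fun s => ∃ M, ∀ t ∈ s, ∀ x, |u t x| ≤ M)
    ⟨0, by simp⟩ (fun s t hst ⟨M, hM⟩ => ⟨M, fun r hr => hM r (hst hr)⟩)
    (fun s t ⟨M, hM⟩ ⟨N, hN⟩ => ⟨max M N, fun r hr x => ?_⟩) fun t₀ ht₀ => ?_
  · rcases hr with hr | hr
    · exact (hM r hr x).trans (le_max_left _ _)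
    · exact (hN r hr x).trans (le_max_right _ _)
  · have ht₀' := Icc_subset_timeInterval hτ ht₀
    have hev : ∀ᶠ t in 𝓝[Icc 0 τ] t₀,
        sobolevNorm SpatialDomain.line n (fun x => u t x - u t₀ x) < 1 :=
      (((h.continuous_sobolev.2 t₀ ht₀').mono_left
        (nhdsWithin_mono _ (Icc_subset_timeInterval hτ))).eventually_lt_const one_pos)
    refine ⟨_, inter_mem hev self_mem_nhdsWithin,
      1 + (sobolevNorm SpatialDomain.line n (u t₀)).toReal, ?_⟩
    rintro t ⟨ht, htI⟩ x
    have ht' := Icc_subset_timeInterval hτ htI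
    have h1 : |u t x - u t₀ x| ≤ 1 := by
      have := (ofReal_abs_le_sobolevNorm_line hn
        (fun y => (hx t ht' y).fun_sub (hx t₀ ht₀' y)) ((hcx' t ht').sub (hcx' t₀ ht₀')) x).trans
        (le_of_lt ht)
      simpa using this
    have h2 : |u t₀ x| ≤ (sobolevNorm SpatialDomain.line n (u t₀)).toReal :=
      (ENNReal.ofReal_le_iff_le_toReal (h.continuous_sobolev.1 t₀ ht₀').2.ne).1
        (ofReal_abs_le_sobolevNorm_line hn (hx t₀ ht₀') (hcx' t₀ ht₀') x)
    calc |u t x| = |(u t x - u t₀ x) + u t₀ x| := by rw [sub_add_cancel]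
      _ ≤ _ := (abs_add_le _ _).trans (add_le_add h1 h2)

theorem exists_bound (h : IsStrongSolution K n u₀ T u) (hn : 1 ≤ n) (hT : 0 < T) {τ : ℝ}
    (hτ : τ ∈ timeInterval T) : ∃ M, ∀ t ∈ Icc 0 τ, ∀ x, |u t x| ≤ M := by
  cases K with
  | line => exact h.exists_bound_line hn hT hτ
  | circle => exact h.exists_bound_circle hτ

theorem hasDerivAt_dxLambdaInv (h : IsStrongSolution K n u₀ T u) (hn : 1 ≤ n) {t : ℝ}
    (ht : t ∈ timeInterval T) {f' : ℝ → ℝ} (hf : ∀ x, HasDerivAt (u t) (f' x) x)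
    (hf' : Continuous f') (x : ℝ) :
    HasDerivAt (fun x => K.dxLambdaInv (fun y => u t y ^ 2 + 2 * u t y * f' y) x + u t x ^ 2)
      (K.dxLambdaInv (fun y => u t y ^ 2 + 2 * u t y * f' y) x) x := by
  have hc : Continuous (u t) := continuous_iff_continuousAt.2 fun x => (hf x).continuousAt
  have hd : ∀ y, HasDerivAt (fun y => u t y ^ 2) (2 * u t y * f' y) y := fun y =>
    ((hf y).fun_pow 2).congr_deriv (by simp)
  have hmem := h.continuous_sobolev.1 t ht
  cases K with
  | line =>
    obtain ⟨h0, h1⟩ := memLp_of_sobolevNorm_line_lt_top hn hf hf' hmem.2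
    refine SpatialDomain.hasDerivAt_dxLambdaInv_line hd h0.integrable_sq ?_ x
    simpa [mul_assoc] using (h0.integrable_mul h1).const_mul 2
  | circle =>
    have hper : Function.Periodic (u t) 1 := hmem.1
    exact SpatialDomain.hasDerivAt_dxLambdaInv_circle hd ((hc.const_mul 2).mul hf')
      (fun y => by simp only [hper y]) x

/-- A strong solution, stopped at a time `τ`, solves the transport form of the equation. -/
theorem isTransportSolution (h : IsStrongSolution K n u₀ T u) (hn : 1 ≤ n) (hT : 0 < T) {τ : ℝ}
    (hτ : τ ∈ timeInterval T) :
    ∃ ut, IsTransportSolution τ (fun t => u (projIcc 0 τ hτ.1 t))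
      (fun t => deriv (u (projIcc 0 τ hτ.1 t))) ut := by
  obtain ⟨ux, ut, hcx, hct, hx, ht⟩ := h.exists_partials hT
  obtain ⟨M, hM⟩ := h.exists_bound hn hT hτ
  have hmem : ∀ t, (projIcc 0 τ hτ.1 t : ℝ) ∈ timeInterval T := fun t =>
    Icc_subset_timeInterval hτ (projIcc 0 τ hτ.1 t).2
  have hcomp : ∀ g : ℝ → ℝ → ℝ,
      ContinuousOn (fun p : ℝ × ℝ => g p.1 p.2) (timeInterval T ×ˢ univ) →
      Continuous fun p : ℝ × ℝ => g (projIcc 0 τ hτ.1 p.1) p.2 := fun g hg =>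
    hg.comp_continuous (f := fun p : ℝ × ℝ => ((projIcc 0 τ hτ.1 p.1 : ℝ), p.2))
      (((continuous_subtype_val.comp continuous_projIcc).comp continuous_fst).prodMk
        continuous_snd) fun p => ⟨hmem p.1, mem_univ _⟩
  have hux : ∀ t, deriv (u (projIcc 0 τ hτ.1 t)) = ux (projIcc 0 τ hτ.1 t) := fun t =>
    funext fun x => (hx _ (hmem t) x).deriv
  simp only [hux]
  refine ⟨fun t => ut (projIcc 0 τ hτ.1 t), hcomp u h.contDiff.continuousOn, hcomp ux hcx,
    hcomp ut hct, fun t => hx _ (hmem t), ?_, ⟨M, fun t x => hM _ (projIcc 0 τ hτ.1 t).2 x⟩, ?_⟩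
  · intro t ht' x
    rw [projIcc_of_mem hτ.1 (Ioo_subset_Icc_self ht')]
    have hnhds : Icc 0 τ ∈ 𝓝 t := Icc_mem_nhds ht'.1 ht'.2
    refine ((ht t (Icc_subset_timeInterval hτ (Ioo_subset_Icc_self ht')) x).hasDerivAt
      (mem_of_superset hnhds (Icc_subset_timeInterval hτ))).congr_of_eventuallyEq ?_
    filter_upwards [hnhds] with s hs
    rw [projIcc_of_mem hτ.1 hs]
  · intro t x
    generalize hs : (projIcc 0 τ hτ.1 t : ℝ) = s
    have hsT : s ∈ timeInterval T := hs ▸ hmem t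
    have hcs : Continuous (ux s) :=
      hcx.comp_continuous (Continuous.prodMk_right s) fun x => ⟨hsT, mem_univ x⟩
    have heq : ∀ y, ut s y = 2 * u s y * ux s y +
        K.dxLambdaInv (fun y => u s y ^ 2 + 2 * u s y * ux s y) y := by
      intro y
      have h1 := h.equation s hsT y
      rw [(ht s hsT y).derivWithin (uniqueDiffOn_timeInterval hT s hsT),
        (hx s hsT y).deriv] at h1
      have h2 : ∀ y, deriv (fun z => u s z ^ 2) y = 2 * u s y * ux s y := fun y => by
        rw [((hx s hsT y).fun_pow 2).deriv]
        simp
      simp only [h2] at h1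
      linarith
    -- The flux u_t + 2u(u - u_x) equals F + 2u² = (F + u²) + u², with derivative F + 2 u u_x = u_t.
    have hd := (h.hasDerivAt_dxLambdaInv hn hsT (hx s hsT) hcs x).fun_add
      ((hx s hsT x).fun_pow 2)
    refine (hd.congr_deriv ?_).congr_of_eventuallyEq (Eventually.of_forall fun y => ?_)
    · rw [heq x]
      push_cast
      ring
    · simp only [heq y]
      ring

/-- Two continuous functions that agree almost everywhere coincide, so the initial profile, and any
bound built from it, depends on u₀ alone. -/
theorem initial_eq {T' : EReal} {v : ℝ → ℝ → ℝ} (h : IsStrongSolution K n u₀ T u) (hT : 0 < T)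
    (h' : IsStrongSolution K n u₀ T' v) (hT' : 0 < T') : u 0 = v 0 := by
  obtain ⟨ux, -, -, -, hx, -⟩ := h.exists_partials hT
  obtain ⟨vx, -, -, -, hx', -⟩ := h'.exists_partials hT'
  exact Continuous.ae_eq_iff_eq volume
    (continuous_iff_continuousAt.2 fun x => (hx 0 (zero_mem_timeInterval hT) x).continuousAt)
    (continuous_iff_continuousAt.2 fun x => (hx' 0 (zero_mem_timeInterval hT') x).continuousAt)
    |>.1 (h.initial.trans h'.initial.symm)

/-- A bound of `u_x` in terms of a bound of the initial value and of its integral. -/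
theorem abs_deriv_le (h : IsStrongSolution K n u₀ T u) (hn : 1 ≤ n) (hT : 0 < T)
    (hu₀ : Integrable u₀ K.measure) (hm₀ : MomentumNonneg u₀) {M : ℝ} (hM : ∀ x, |u 0 x| ≤ M)
    {t : ℝ} (ht : t ∈ timeInterval T) (x : ℝ) :
    |deriv (u t) x| ≤ (∫ y, |u 0 y|) + 2 * M + M / (1 - Real.exp (-1)) := by
  obtain ⟨ut, hs⟩ := h.isTransportSolution hn hT ht
  have hleft : (projIcc 0 t ht.1 0 : ℝ) = 0 := by
    rw [projIcc_of_mem ht.1 (left_mem_Icc.2 ht.1)]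
  have hright : (projIcc 0 t ht.1 t : ℝ) = t := by
    rw [projIcc_of_mem ht.1 (right_mem_Icc.2 ht.1)]
  have hM0 : 0 ≤ M := (abs_nonneg _).trans (hM 0)
  have hmono : Monotone fun x => Real.exp x * (u (projIcc 0 t ht.1 0) x -
      deriv (u (projIcc 0 t ht.1 0)) x) := by
    refine (hm₀.congr (g := u (projIcc 0 t ht.1 0)) ?_).monotone (hs.hasDerivAt_x 0)
      (hs.continuous_ux.comp (Continuous.prodMk_right 0))
    rw [hleft]
    exact h.initial
  have h1 := hs.abs_deriv_le ht.1 hmono x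
  simp only [hright] at h1
  refine h1.trans ?_
  have h3 : Real.exp (-1) < 1 := by simp
  cases K with
  | line =>
    have hint : Integrable (u 0) := by
      refine Integrable.congr ?_ h.initial.symm
      simpa [SpatialDomain.measure, SpatialDomain.carrier] using hu₀
    have h2 := hs.le_of_integrable ht.1 hmono (M := M) (by simpa only [hleft] using hM)
      (by simpa only [hleft] using hint) x
    simp only [hleft, hright] at h2
    have : 0 ≤ M / (1 - Real.exp (-1)) := div_nonneg hM0 (by linarith)
    linarith
  | circle =>
    have h2 := hs.le_of_periodic ht.1 hmono (M := M) (by simpa only [hleft] using hM)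
      (fun s => (h.continuous_sobolev.1 _
        (Icc_subset_timeInterval ht (projIcc 0 t ht.1 s).2)).1) x
    simp only [hright] at h2
    -- On the circle this integral over the whole line is not the mass of a period; only its sign is
    -- used, to fit one constant to both domains.
    have : 0 ≤ ∫ y, |u 0 y| := integral_nonneg fun y => abs_nonneg _
    linarith

end IsStrongSolution
end PseudoEq
end

theorem lemma4p1 (K : PseudoEq.SpatialDomain) (n : ℕ) (hn : 1 ≤ n) (u₀ : ℝ → ℝ)
    (hu₀ : PseudoEq.MemSobolev K n u₀) (hu₀_int : MeasureTheory.Integrable u₀ K.measure)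
    (hm₀ : PseudoEq.MomentumNonneg u₀) :
    ∃ C : ℝ, 0 < C ∧
      ∀ (T : EReal) (u : ℝ → ℝ → ℝ), 0 < T → PseudoEq.IsStrongSolution K n u₀ T u →
        ∀ t ∈ PseudoEq.timeInterval T,
          MeasureTheory.eLpNorm (deriv (u t)) ⊤ K.measure ≤ ENNReal.ofReal C := by
  -- The constant must precede T and u: it is read off from the initial profile of any one solution,
  -- shared by all the others. Without solutions the claim is vacuous.
  by_cases hex : ∃ (T : EReal) (v : ℝ → ℝ → ℝ), 0 < T ∧ PseudoEq.IsStrongSolution K n u₀ T v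
  · obtain ⟨T', v, hT', hv⟩ := hex
    obtain ⟨M, hM⟩ := hv.exists_bound hn hT' (PseudoEq.zero_mem_timeInterval hT')
    have hM' : ∀ x, |v 0 x| ≤ M := hM 0 (Set.left_mem_Icc.2 le_rfl)
    refine ⟨max 1 ((∫ y, |v 0 y|) + 2 * M + M / (1 - Real.exp (-1))), by positivity, ?_⟩
    intro T u hT hu t ht
    have h0 := hu.initial_eq hT hv hT'
    rw [MeasureTheory.eLpNorm_exponent_top]
    refine MeasureTheory.eLpNormEssSup_le_of_ae_bound (Filter.Eventually.of_forall fun x => ?_)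
    rw [← h0] at hM' ⊢
    exact (hu.abs_deriv_le hn hT hu₀_int hm₀ hM' ht x).trans (le_max_right _ _)
  · exact ⟨1, one_pos, fun T u hT hu => absurd ⟨T, u, hT, hu⟩ hex⟩
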